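/- Let $u$ be a nonzero square of an integer such that $p=4u^2+12u+1$ is prime, and let $U_p$ be the set of primitive elements (generators of $\mathbb F_p^*$) of $\mathbb F_p$. For $\alpha\in U_p$ and $N\mid p-1$ put $C_i^N=\alpha^i\langle\alpha^N\rangle$, and for $0\le i,j\le 7$ let $(i,j)_\alpha$ be the number of pairs $(v,w)$ with $0\le v,w\le \frac{p-1}{8}-1$ and $1+\alpha^{8v+i}=\alpha^{8w+j}$ (the cyclotomic numbers of order $8$). Subsets $S,T$ of $\mathbb F_p$ form an $(s,t)$-$\lambda$-fold near-factorization of $(\mathbb F_p,+)$, where $\lambda\ge1$, if $|S|=s$, $|T|=t$, every nonzero element of $\mathbb F_p$ can be written as $a+b$ with $a\in S$, $b\in T$ in exactly $\lambda$ ways, and $0$ cannot be so written (that is, $ST=\lambda(\mathbb F_p-0)$ in the integral group ring of $(\mathbb F_p,+)$). For every $\alpha\in U_p$ there is a unique quadruple of integers $(x,y,a,b)=(x_\alpha,y_\alpha,a_\alpha,b_\alpha)$ such that $p=x^2+4y^2=a^2+2b^2$, $x\equiv a\equiv1\pmod 4$, and the signs of $y,b$ are normalized by $$64(0,2)_\alpha=p-7+6x+16y,\qquad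 64(0,1)_\alpha=p-7+2x+4a+16y+16b\qquad\text{if }2\in C_0^4,$$ $$64(0,2)_\alpha=p-7-2x-8a-16y,\qquad 64(1,3)_\alpha=p+1+2x-4a-16b\qquad\text{if }2\in C_2^4,$$ one of these two cases always occurring. Put $U_p^+=\{\alpha\in U_p: y_\alpha=b_\alpha\}$ and $U_p^-=\{\alpha\in U_p: y_\alpha=-b_\alpha\}$. Then $U_p$ is the disjoint union of $U_p^+$ and $U_p^-$, both sets are nonempty, and the following holds. (1) If $\alpha\in U_p^+$, then $(C_0^8\cup C_1^8,\,C_4^8\cup C_5^8)$ and $(C_0^8\cup C_7^8,\,C_3^8\cup C_4^8)$ are $\left(\frac{p-1}4,\frac{p-1}4\right)$-$\lambda$-fold near-factorizations of $(\mathbb F_p,+)$ with $\lambda=\frac{p-1}{16}$. (2) If $\alpha\in U_p^-$, then $(C_0^8\cup C_5^8,\,C_1^8\cup C_4^8)$ and $(C_0^8\cup C_3^8,\,C_4^8\cup C_7^8)$ are $\left(\frac{p-1}4,\frac{p-1}4\right)$-$\lambda$-fold near-factorizations of $(\mathbb F_p,+)$ with $\lambda=\frac{p-1}{16}$. -/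

import Mathlib

/-- `(S, T)` is an `(s, t)`-`lam`-fold near-factorization of the finite additive group `G`:
`|S| = s`, `|T| = t`, `lam` is positive, and `S T = lam (G - 0)` in the integral group ring, that is
every nonzero `g` is `a + b` with `a ∈ S`, `b ∈ T` in exactly `lam` ways, and `0` in no way. -/
structure IsNearFactorization {G : Type*} [AddGroup G] [Finite G]
    (s t lam : ℕ) (S T : Set G) : Prop where
  card_left : S.ncard = s
  card_right : T.ncard = t
  pos : 0 < lam
  zero : {q : G × G | q.1 ∈ S ∧ q.2 ∈ T ∧ q.1 + q.2 = 0}.ncard = 0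
  nonzero : ∀ g : G, g ≠ 0 → {q : G × G | q.1 ∈ S ∧ q.2 ∈ T ∧ q.1 + q.2 = g}.ncard = lam

/-- The set of primitive elements of `F_p`: the generators of its multiplicative group. -/
def primitiveElements (p : ℕ) : Set (ZMod p)ˣ :=
  {α | Subgroup.zpowers α = ⊤}

/-- The cyclotomic coset `C_i^N = α ^ i ⟨α ^ N⟩`, as a subset of `F_p`. -/
def cyclotomicCoset {p : ℕ} (N : ℕ) (α : (ZMod p)ˣ) (i : ℕ) : Set (ZMod p) :=
  {z | ∃ h ∈ Subgroup.zpowers (α ^ N), z = ((α ^ i * h : (ZMod p)ˣ) : ZMod p)}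

/-- The order `N` cyclotomic number `(i, j)` with respect to `α`: with `f = (p - 1) / N`, the number
of pairs `(v, w)`, `0 ≤ v, w ≤ f - 1`, such that `1 + α ^ (N v + i) = α ^ (N w + j)`. -/
def cyclotomicNumber {p : ℕ} (N : ℕ) (α : (ZMod p)ˣ) (i j : ℕ) : ℕ :=
  ((Finset.range ((p - 1) / N) ×ˢ Finset.range ((p - 1) / N)).filter
    fun q => (1 : ZMod p) + (α : ZMod p) ^ (N * q.1 + i) = (α : ZMod p) ^ (N * q.2 + j)).card

/-- The integers `x, y, a, b` attached to `α` (for `p ≡ 1 mod 16` and `α` a primitive element) in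
the description of the order `8` cyclotomic numbers:
`p = x² + 4y² = a² + 2b²` with `x ≡ a ≡ 1 mod 4`, which fixes `x, a` and the absolute values of
`y, b`; the signs of `y` and `b` are those for which the tabulated formulas for the order `8`
cyclotomic numbers with respect to `α` hold. One entry of the table containing `y` and one
containing `b` pin down the two signs. -/
structure IsLehmerQuadruple {p : ℕ} (α : (ZMod p)ˣ) (x y a b : ℤ) : Prop where
  eq_x_y : (p : ℤ) = x ^ 2 + 4 * y ^ 2
  x_mod : x ≡ 1 [ZMOD 4]
  eq_a_b : (p : ℤ) = a ^ 2 + 2 * b ^ 2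
  a_mod : a ≡ 1 [ZMOD 4]
  signs :
    ((2 : ZMod p) ∈ cyclotomicCoset 4 α 0 ∧
      64 * (cyclotomicNumber 8 α 0 2 : ℤ) = p - 7 + 6 * x + 16 * y ∧
      64 * (cyclotomicNumber 8 α 0 1 : ℤ) = p - 7 + 2 * x + 4 * a + 16 * y + 16 * b) ∨
    ((2 : ZMod p) ∈ cyclotomicCoset 4 α 2 ∧
      64 * (cyclotomicNumber 8 α 0 2 : ℤ) = p - 7 - 2 * x - 8 * a - 16 * y ∧
      64 * (cyclotomicNumber 8 α 1 3 : ℤ) = p + 1 + 2 * x - 4 * a - 16 * b)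

/-- `U_p^+`: the primitive elements `α` with `y_α = b_α`. -/
def primitivePlus (p : ℕ) : Set (ZMod p)ˣ :=
  {α | α ∈ primitiveElements p ∧ ∃ x y a b : ℤ, IsLehmerQuadruple α x y a b ∧ y = b}

/-- `U_p^-`: the primitive elements `α` with `y_α = - b_α`. -/
def primitiveMinus (p : ℕ) : Set (ZMod p)ˣ :=
  {α | α ∈ primitiveElements p ∧ ∃ x y a b : ℤ, IsLehmerQuadruple α x y a b ∧ y = -b}

section

open Finset

/-! ### Identities between Jacobi sums over a finite field. -/

section JacobiSums

variable {F : Type*} [Field F] [Fintype F] [DecidableEq F]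

/-! Let `χ` be an octic character with `χ α = ζ`. By orthogonality, 64 times the number of ways to
write `α ^ k` as an element of `C_i^8` plus one of `C_j^8` is a finite Fourier transform of the
Jacobi sums `J(χ^r, χ^s)` (`octicCount_eq`); cyclotomic numbers are the case `k = 0`. Since `16 ∣ p
- 1`, all these sums reduce to `ε = χ 4 = ±1`, `K = J(χ, χ³)`, `M = J(χ², χ²)` and the conjugates of
`K` and `M` (`isOcticTable`). Here `K = -a + b(ζ + ζ³)` lies in `ℤ[√-2]` and `M = -x + 2yζ²` in
`ℤ[i]`; both have norm `p`, and integrality of cyclotomic numbers gives `x ≡ a ≡ 1 mod 4`. So the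
quadruple attached to `α` is read off from `K` and `M` (`exists_isJacobiQuadruple`).

If `y = b` and `a + x = 2ε`, the transforms belonging to `{0,1}` and `{4,5}` add up to `4(p - 1)`
for every `k` (`transform_add_eq_const`), which is the near-factorization. The special form of `p`
supplies both conditions, up to a sign: `p = (2u - 1)² + 4·4u = (2u + 1)² + 2·4u` with `u` a square,
so `y² = b² = 4u`, and `a + x = ±2`, with the sign matched to `ε` by integrality of `(0,2)`
(`sq_eq_and_add_eq`).

The case `y = -b` follows by writing the same Jacobi sums in terms of `ζ⁵`, which flips `b` alone.
Replacing `α` by a power with exponent `3 mod 8` flips `y` alone, so both signs occur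
(`exists_neg`). -/

theorem jacobiSum_eq_jacobiSum_inv_mul (χ ψ : MulChar F ℂ) :
    jacobiSum χ ψ = χ (-1) * jacobiSum χ (χ * ψ)⁻¹ := by
  have key : ∀ φ : MulChar F ℂ, jacobiSum χ φ = ∑ x ∈ univ.erase (1 : F), χ x * φ (1 - x) := by
    intro φ
    rw [jacobiSum, ← Finset.add_sum_erase _ _ (mem_univ (1 : F)), sub_self, φ.map_zero, mul_zero,
      zero_add]
  rw [key, key, Finset.mul_sum]
  have h1 : ∀ t ∈ univ.erase (1 : F), t - 1 ≠ 0 := fun t ht => sub_ne_zero.2 (by simpa using ht)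
  -- The involution `t ↦ t / (t - 1)` turns `1 - t` into its inverse.
  refine Finset.sum_nbij' (fun t => t / (t - 1)) (fun t => t / (t - 1)) ?_ ?_ ?_ ?_ ?_
  · intro t ht
    have := h1 t ht
    simp only [mem_erase, mem_univ, and_true, ne_eq]
    rw [div_eq_one_iff_eq this]
    intro h
    exact one_ne_zero (by linear_combination h : (1 : F) = 0)
  · intro t ht
    have := h1 t ht
    simp only [mem_erase, mem_univ, and_true, ne_eq]
    rw [div_eq_one_iff_eq this]
    intro h
    exact one_ne_zero (by linear_combination h : (1 : F) = 0)
  · intro t ht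
    have := h1 t ht
    field_simp
    ring
  · intro t ht
    have := h1 t ht
    field_simp
    ring
  · intro t ht
    have h := h1 t ht
    have e : 1 - t / (t - 1) = (1 - t)⁻¹ := by
      have : (1 - t) ≠ 0 := by rwa [← neg_sub, neg_ne_zero]
      field_simp
      ring
    have hu : IsUnit (1 - t) := IsUnit.mk0 _ (by rwa [← neg_sub, neg_ne_zero])
    rw [e, MulChar.inv_apply', inv_inv, MulChar.mul_apply]
    have e2 : t = (-1) * (t / (t - 1)) * (1 - t) := by
      field_simp
      ring
    have e3 : χ t = χ (-1) * χ (t / (t - 1)) * χ (1 - t) := by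
      rw [← map_mul, ← map_mul, ← e2]
    rw [e3]
    ring

/-- Completing the square: `4x(1 - x) = 1 - (2x - 1)²`. The hypothesis on `φ` says that it is the
quadratic character, in the form needed to count the `z` with given square. -/
theorem map_four_mul_jacobiSum_self {χ φ : MulChar F ℂ} (hχ : χ ≠ 1) (h2 : (2 : F) ≠ 0)
    (hφ : ∀ w : F, (#{z : F | z ^ 2 = w} : ℂ) = φ w + 1) :
    χ 4 * jacobiSum χ χ = jacobiSum χ φ := by
  have e1 : χ 4 * jacobiSum χ χ = ∑ z : F, χ (1 - z ^ 2) := by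
    rw [jacobiSum, Finset.mul_sum]
    refine Finset.sum_bijective (fun x => 2 * x - 1) ?_ (by simp) ?_
    · refine ⟨fun x y h => ?_, fun y => ⟨(y + 1) / 2, by field_simp; ring⟩⟩
      exact mul_left_cancel₀ h2 (by simpa using h)
    · intro x _
      rw [← map_mul, ← map_mul]
      congr 1
      ring
  have e2 : ∑ z : F, χ (1 - z ^ 2) = ∑ w : F, (#{z : F | z ^ 2 = w} : ℂ) * χ (1 - w) := by
    rw [← Finset.sum_fiberwise univ (fun z : F => z ^ 2)]
    refine Finset.sum_congr rfl fun w _ => ?_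
    rw [← nsmul_eq_mul]
    refine Finset.sum_eq_card_nsmul fun z hz => ?_
    rw [(mem_filter.1 hz).2]
  have e3 : ∑ w : F, χ (1 - w) = 0 := by
    rw [← MulChar.sum_eq_zero_of_ne_one hχ]
    exact (Equiv.subLeft (1 : F)).sum_comp χ
  rw [e1, e2, jacobiSum_comm, jacobiSum]
  simp only [hφ, add_mul, one_mul, Finset.sum_add_distrib, e3, add_zero]

/-- Both sides equal `g(χ) g(φ) g(θ) / g(χφθ)` in Gauss sums; this is the cocycle identity. -/
theorem jacobiSum_mul_jacobiSum {p : ℕ} [Fact p.Prime] {χ φ θ : MulChar (ZMod p) ℂ}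
    (h1 : χ * φ ≠ 1) (h2 : φ * θ ≠ 1) (h3 : χ * φ * θ ≠ 1) :
    jacobiSum χ φ * jacobiSum (χ * φ) θ = jacobiSum χ (φ * θ) * jacobiSum φ θ := by
  have hp : ((Fintype.card (ZMod p) : ℕ) : ℂ) ≠ 0 := by
    rw [ZMod.card]; exact_mod_cast (Fact.out : p.Prime).ne_zero
  have hψ := ZMod.isPrimitive_stdAddChar p
  have g1 := jacobiSum_mul_nontrivial h1 (ZMod.stdAddChar (N := p))
  have g2 := jacobiSum_mul_nontrivial h2 (ZMod.stdAddChar (N := p))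
  have g3 := jacobiSum_mul_nontrivial h3 (ZMod.stdAddChar (N := p))
  have g4 := jacobiSum_mul_nontrivial (by rwa [← mul_assoc] : χ * (φ * θ) ≠ 1)
    (ZMod.stdAddChar (N := p))
  have n1 := gaussSum_ne_zero_of_nontrivial hp h1 hψ
  have n2 := gaussSum_ne_zero_of_nontrivial hp h2 hψ
  have n3 := gaussSum_ne_zero_of_nontrivial hp h3 hψ
  rw [← mul_assoc] at g4
  apply mul_left_cancel₀ (mul_ne_zero (mul_ne_zero n1 n2) n3)
  generalize jacobiSum χ φ = a at *
  generalize jacobiSum (χ * φ) θ = b at *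
  generalize jacobiSum χ (φ * θ) = c at *
  generalize jacobiSum φ θ = d at *
  generalize gaussSum χ _ = x at *
  generalize gaussSum φ _ = y at *
  generalize gaussSum θ _ = z at *
  generalize gaussSum (χ * φ) _ = xy at *
  generalize gaussSum (φ * θ) _ = yz at *
  generalize gaussSum (χ * φ * θ) _ = xyz at *
  calc xy * yz * xyz * (a * b) = (xy * a) * (xyz * b) * yz := by ring
    _ = (xyz * c) * (yz * d) * xy := by rw [g1, g2, g3, g4]; ring
    _ = _ := by ring

end JacobiSums

/-! ### Octic characters and the rings containing their Jacobi sums. -/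

/-- `χ` is an octic character of `F_p` with `χ α = ζ`, a primitive eighth root of unity, for the
primitive element `α`, where `p ≡ 1 mod 16`. -/
structure IsOcticCharacter {p : ℕ} [Fact p.Prime] (α : (ZMod p)ˣ) (χ : MulChar (ZMod p) ℂ)
    (ζ : ℂ) : Prop where
  primitive : α ∈ primitiveElements p
  apply_gen : χ α = ζ
  pow_four : ζ ^ 4 = -1
  dvd : 16 ∣ p - 1

theorem sum_pow_eq_sum_card_mul_pow {ι : Type*} {ω : ℂ} (hω : ω ^ 8 = 1) (s : Finset ι)
    (n : ι → ℕ) :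
    ∑ x ∈ s, ω ^ n x = ∑ k ∈ range 8, (#{x ∈ s | n x % 8 = k} : ℂ) * ω ^ k := by
  rw [← Finset.sum_fiberwise_of_maps_to (t := range 8) (g := fun x => n x % 8)
    (fun x _ => mem_range.2 (Nat.mod_lt _ (by norm_num)))]
  refine Finset.sum_congr rfl fun k _ => ?_
  rw [← nsmul_eq_mul]
  refine Finset.sum_eq_card_nsmul fun z hz => ?_
  rw [← (mem_filter.1 hz).2]
  conv_lhs => rw [← Nat.div_add_mod (n z) 8, pow_add, pow_mul, hω, one_pow, one_mul]

namespace IsOcticCharacter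

variable {p : ℕ} [Fact p.Prime] {α : (ZMod p)ˣ} {χ : MulChar (ZMod p) ℂ} {ζ : ℂ}

theorem pow_eight (h : IsOcticCharacter α χ ζ) : ζ ^ 8 = 1 := by
  rw [show ζ ^ 8 = (ζ ^ 4) ^ 2 by ring, h.pow_four]; norm_num

theorem orderOf_root (h : IsOcticCharacter α χ ζ) : orderOf ζ = 8 := by
  refine orderOf_eq_prime_pow (p := 2) (n := 2) ?_ h.pow_eight
  norm_num [h.pow_four]

theorem pow_mod (h : IsOcticCharacter α χ ζ) (m : ℕ) : ζ ^ m = ζ ^ (m % 8) := by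
  conv_lhs => rw [← Nat.div_add_mod m 8, pow_add, pow_mul, h.pow_eight, one_pow, one_mul]

theorem pow_eq_pow_iff (h : IsOcticCharacter α χ ζ) {m n : ℕ} :
    ζ ^ m = ζ ^ n ↔ m % 8 = n % 8 := by
  refine ⟨fun e => ?_, fun e => by rw [h.pow_mod m, h.pow_mod n, e]⟩
  rw [h.pow_mod m, h.pow_mod n] at e
  have hζ := IsPrimitiveRoot.orderOf ζ
  rw [h.orderOf_root] at hζ
  exact hζ.pow_inj (Nat.mod_lt _ (by norm_num)) (Nat.mod_lt _ (by norm_num)) e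

theorem orderOf_gen (h : IsOcticCharacter α χ ζ) : orderOf α = p - 1 := by
  have := (orderOf_eq_card_of_forall_mem_zpowers (g := α) fun x => by
    rw [show Subgroup.zpowers α = ⊤ from h.primitive]; trivial)
  rw [this, Nat.card_eq_fintype_card, ZMod.card_units]

theorem exists_pow (h : IsOcticCharacter α χ ζ) (z : (ZMod p)ˣ) : ∃ k : ℕ, α ^ k = z := by
  have : z ∈ Subgroup.zpowers α := by
    rw [show Subgroup.zpowers α = ⊤ from h.primitive]; trivial
  simpa [Submonoid.mem_powers_iff] using mem_powers_iff_mem_zpowers.2 this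

theorem exists_pow_of_ne_zero (h : IsOcticCharacter α χ ζ) {z : ZMod p} (hz : z ≠ 0) :
    ∃ k : ℕ, z = (α : ZMod p) ^ k := by
  obtain ⟨k, hk⟩ := h.exists_pow (Units.mk0 z hz)
  exact ⟨k, by rw [← Units.val_pow_eq_pow_val, hk]; rfl⟩

theorem apply_pow (h : IsOcticCharacter α χ ζ) (k : ℕ) : χ ((α : ZMod p) ^ k) = ζ ^ k := by
  rw [map_pow, h.apply_gen]

theorem sixteen_lt (h : IsOcticCharacter α χ ζ) : 16 < p := by
  have := (Fact.out : p.Prime).two_le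
  have := Nat.le_of_dvd (by omega) h.dvd
  omega

theorem two_ne_zero (h : IsOcticCharacter α χ ζ) : (2 : ZMod p) ≠ 0 := by
  intro e
  have : p ∣ 2 := (ZMod.natCast_eq_zero_iff 2 p).1 (by exact_mod_cast e)
  have := Nat.le_of_dvd (by norm_num) this
  have := h.sixteen_lt
  omega

theorem neg_one_eq_pow (h : IsOcticCharacter α χ ζ) :
    (-1 : ZMod p) = (α : ZMod p) ^ ((p - 1) / 2) := by
  have h1 : ((α : ZMod p) ^ ((p - 1) / 2)) ^ 2 = 1 := by
    have e : (p - 1) / 2 * 2 = p - 1 := by have := h.dvd; omega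
    rw [← pow_mul, e, ← h.orderOf_gen, ← Units.val_pow_eq_pow_val, pow_orderOf_eq_one,
      Units.val_one]
  rcases mul_self_eq_one_iff.1 ((sq _).symm.trans h1) with h2 | h2
  · exfalso
    have : α ^ ((p - 1) / 2) = 1 := by ext; simpa using h2
    have := orderOf_dvd_of_pow_eq_one this
    rw [h.orderOf_gen] at this
    have := Nat.le_of_dvd (by have := h.sixteen_lt; omega) this
    have := h.sixteen_lt
    omega
  · exact h2.symm

theorem apply_neg_one (h : IsOcticCharacter α χ ζ) : χ (-1) = 1 := by
  obtain ⟨m, hm⟩ := h.dvd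
  rw [h.neg_one_eq_pow, h.apply_pow, show (p - 1) / 2 = 8 * m by omega, pow_mul,
    h.pow_eight, one_pow]

theorem pow_eight_eq_one (h : IsOcticCharacter α χ ζ) : χ ^ 8 = 1 := by
  ext z
  obtain ⟨k, rfl⟩ := h.exists_pow z
  rw [MulChar.pow_apply_coe, Units.val_pow_eq_pow_val, h.apply_pow, ← pow_mul, mul_comm, pow_mul,
    h.pow_eight, one_pow, ← Units.val_pow_eq_pow_val, MulChar.one_apply_coe]

theorem pow_ne_one (h : IsOcticCharacter α χ ζ) {r : ℕ} (hr : ¬ 8 ∣ r) : χ ^ r ≠ 1 := by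
  intro e
  have : (χ ^ r) α = 1 := by rw [e, MulChar.one_apply_coe]
  rw [MulChar.pow_apply_coe, h.apply_gen] at this
  exact hr (h.orderOf_root ▸ orderOf_dvd_of_pow_eq_one this)

theorem card_sqrts (h : IsOcticCharacter α χ ζ) (w : ZMod p) :
    (#{z : ZMod p | z ^ 2 = w} : ℂ) = (χ ^ 4) w + 1 := by
  have hp : ringChar (ZMod p) ≠ 2 := by
    rw [ZMod.ringChar_zmod_n]; have := h.sixteen_lt; omega
  have key := quadraticChar_card_sqrts hp w
  have hq : χ ^ 4 = (quadraticChar (ZMod p)).ringHomComp (Int.castRingHom ℂ) := by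
    rw [MulChar.eq_iff (g := α) (fun x => by
      rw [show Subgroup.zpowers α = ⊤ from h.primitive]; trivial)]
    rw [MulChar.pow_apply_coe, h.apply_gen, h.pow_four, MulChar.ringHomComp_apply]
    have : quadraticChar (ZMod p) (α : ZMod p) = -1 := by
      rw [quadraticChar_neg_one_iff_not_isSquare]
      rintro ⟨b, hb⟩
      have hb0 : b ≠ 0 := by rintro rfl; simp at hb
      obtain ⟨k, rfl⟩ := h.exists_pow_of_ne_zero hb0
      have e := congrArg χ hb
      rw [← pow_add, h.apply_pow, h.apply_gen] at e
      have : ζ ^ 1 = ζ ^ (k + k) := by rw [pow_one]; exact e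
      rw [h.pow_eq_pow_iff] at this
      omega
    rw [this]; simp
  rw [hq, MulChar.ringHomComp_apply]
  have e : ({x : ZMod p | x ^ 2 = w} : Set (ZMod p)).toFinset =
      ({z : ZMod p | z ^ 2 = w} : Finset _) := by
    ext; simp
  rw [e] at key
  have := congrArg (Int.cast : ℤ → ℂ) key
  push_cast at this
  simpa using this

/-- `2` is a square, so `χ 4 = ± 1`. -/
theorem exists_two_eq_pow (h : IsOcticCharacter α χ ζ) :
    ∃ k : ℕ, (2 : ZMod p) = (α : ZMod p) ^ (2 * k) := by
  have hp := h.sixteen_lt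
  have : IsSquare (2 : ZMod p) := by
    rw [ZMod.exists_sq_eq_two_iff (by omega)]
    have := h.dvd
    omega
  obtain ⟨b, hb⟩ := this
  have hb0 : b ≠ 0 := by rintro rfl; exact h.two_ne_zero (by simpa using hb)
  obtain ⟨k, rfl⟩ := h.exists_pow_of_ne_zero hb0
  exact ⟨k, by rw [hb, ← pow_add, two_mul]⟩

theorem exists_jacobiSum_eq (h : IsOcticCharacter α χ ζ) :
    ∃ n : ZMod p → ℕ, (∀ z ≠ 0, z = (α : ZMod p) ^ n z) ∧ ∀ r s : ℕ,
      jacobiSum (χ ^ r) (χ ^ s) =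
        ∑ x : ZMod p with x ≠ 0 ∧ x ≠ 1, ζ ^ (r * n x + s * n (1 - x)) := by
  have : ∀ z : ZMod p, ∃ k : ℕ, z ≠ 0 → z = (α : ZMod p) ^ k := by
    intro z
    by_cases hz : z = 0
    · exact ⟨0, fun e => absurd hz e⟩
    · obtain ⟨k, hk⟩ := h.exists_pow_of_ne_zero hz
      exact ⟨k, fun _ => hk⟩
  choose n hn using this
  refine ⟨n, hn, fun r s => ?_⟩
  rw [jacobiSum, ← Finset.sum_filter_add_sum_filter_not univ (fun x : ZMod p => x ≠ 0 ∧ x ≠ 1)]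
  have h0 : ∑ x : ZMod p with ¬ (x ≠ 0 ∧ x ≠ 1), (χ ^ r) x * (χ ^ s) (1 - x) = 0 := by
    refine Finset.sum_eq_zero fun x hx => ?_
    rcases (by simpa [or_iff_not_imp_left] using hx : x = 0 ∨ x = 1) with rfl | rfl
    · rw [MulChar.map_zero, zero_mul]
    · rw [sub_self, MulChar.map_zero, mul_zero]
  rw [h0, add_zero]
  have hv : ∀ z : ZMod p, z ≠ 0 → ∀ r : ℕ, (χ ^ r) z = ζ ^ (r * n z) := by
    intro z hz r
    obtain ⟨w, rfl⟩ : IsUnit z := IsUnit.mk0 z hz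
    rw [MulChar.pow_apply_coe, mul_comm, pow_mul, ← h.apply_pow, ← hn _ hz]
  refine Finset.sum_congr rfl fun x hx => ?_
  have hx := (mem_filter.1 hx).2
  rw [hv x hx.1, hv (1 - x) (sub_ne_zero.2 (Ne.symm hx.2)), pow_add]

/-- Swapping `x` and `1 - x` multiplies the exponent `n x + 3 n (1 - x)` by `3` modulo `8`, so the
classes `k` and `3k` are equally populated. Classes `2` and `6` cancel, and what is left is an
integer combination of `1` and `ζ + ζ³`, a square root of `-2`. -/
theorem exists_jacobiSum_one_three (h : IsOcticCharacter α χ ζ) :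
    ∃ a b : ℤ, jacobiSum (χ ^ 1) (χ ^ 3) = a + b * (ζ + ζ ^ 3) ∧
      jacobiSum (χ ^ 7) (χ ^ 5) = a - b * (ζ + ζ ^ 3) := by
  obtain ⟨n, -, hJ⟩ := h.exists_jacobiSum_eq
  set s : Finset (ZMod p) := {x | x ≠ 0 ∧ x ≠ 1} with hs
  set N : ZMod p → ℕ := fun x => n x + 3 * n (1 - x) with hN
  have h4 := h.pow_four
  have h8 := h.pow_eight
  have key : ∀ m : ℕ, ∑ x ∈ s, (ζ ^ m) ^ N x =
      ∑ k ∈ range 8, (#{x ∈ s | N x % 8 = k} : ℂ) * (ζ ^ m) ^ k := fun m =>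
    sum_pow_eq_sum_card_mul_pow (by rw [← pow_mul, mul_comm, pow_mul, h8, one_pow]) s N
  have hsymm : ∀ k < 8, #{x ∈ s | N x % 8 = k} = #{x ∈ s | N x % 8 = 3 * k % 8} := by
    intro k hk
    refine Finset.card_nbij' (fun x => 1 - x) (fun x => 1 - x) ?_ ?_ ?_ ?_
    · intro x hx
      simp only [hs, hN, coe_filter, mem_filter, mem_univ, true_and, Set.mem_ofPred_eq, ne_eq,
        sub_eq_zero, sub_eq_self, sub_sub_cancel] at hx ⊢
      refine ⟨⟨fun e => hx.1.2 e.symm, hx.1.1⟩, ?_⟩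
      have := hx.2
      omega
    · intro x hx
      simp only [hs, hN, coe_filter, mem_filter, mem_univ, true_and, Set.mem_ofPred_eq, ne_eq,
        sub_eq_zero, sub_eq_self, sub_sub_cancel] at hx ⊢
      refine ⟨⟨fun e => hx.1.2 e.symm, hx.1.1⟩, ?_⟩
      have := hx.2
      omega
    · intro x _; simp
    · intro x _; simp
  have k1 := key 1
  have k7 := key 7
  simp only [Finset.sum_range_succ, Finset.sum_range_zero] at k1 k7
  have s1 := hsymm 1 (by norm_num)
  have s2 := hsymm 2 (by norm_num)
  have s5 := hsymm 5 (by norm_num)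
  norm_num at s1 s2 s5
  rw [← s1, ← s2, ← s5] at k1 k7
  refine ⟨(#{x ∈ s | N x % 8 = 0} : ℤ) - #{x ∈ s | N x % 8 = 4},
    (#{x ∈ s | N x % 8 = 1} : ℤ) - #{x ∈ s | N x % 8 = 5}, ?_, ?_⟩
  · have e : jacobiSum (χ ^ 1) (χ ^ 3) = ∑ x ∈ s, (ζ ^ 1) ^ N x := by
      rw [hJ]; exact Finset.sum_congr rfl fun x _ => by rw [← pow_mul]; simp only [hN, one_mul]
    rw [e, k1]
    push_cast
    generalize (#{x ∈ s | N x % 8 = 0} : ℂ) = d0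
    generalize (#{x ∈ s | N x % 8 = 1} : ℂ) = d1
    generalize (#{x ∈ s | N x % 8 = 2} : ℂ) = d2
    generalize (#{x ∈ s | N x % 8 = 4} : ℂ) = d4
    generalize (#{x ∈ s | N x % 8 = 5} : ℂ) = d5
    grind
  · have e : jacobiSum (χ ^ 7) (χ ^ 5) = ∑ x ∈ s, (ζ ^ 7) ^ N x := by
      rw [hJ]
      refine Finset.sum_congr rfl fun x _ => ?_
      rw [← pow_mul, h.pow_eq_pow_iff]
      simp only [hN]
      omega
    rw [e, k7]
    push_cast
    generalize (#{x ∈ s | N x % 8 = 0} : ℂ) = d0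
    generalize (#{x ∈ s | N x % 8 = 1} : ℂ) = d1
    generalize (#{x ∈ s | N x % 8 = 2} : ℂ) = d2
    generalize (#{x ∈ s | N x % 8 = 4} : ℂ) = d4
    generalize (#{x ∈ s | N x % 8 = 5} : ℂ) = d5
    grind

theorem exists_jacobiSum_two_two (h : IsOcticCharacter α χ ζ) :
    ∃ x y : ℤ, jacobiSum (χ ^ 2) (χ ^ 2) = x + y * ζ ^ 2 ∧
      jacobiSum (χ ^ 6) (χ ^ 6) = x - y * ζ ^ 2 := by
  obtain ⟨n, -, hJ⟩ := h.exists_jacobiSum_eq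
  set s : Finset (ZMod p) := {x | x ≠ 0 ∧ x ≠ 1} with hs
  set N : ZMod p → ℕ := fun x => n x + n (1 - x) with hN
  have h4 := h.pow_four
  have h8 := h.pow_eight
  have key : ∀ m : ℕ, jacobiSum (χ ^ m) (χ ^ m) =
      ∑ k ∈ range 8, (#{x ∈ s | N x % 8 = k} : ℂ) * (ζ ^ m) ^ k := fun m => by
    rw [← sum_pow_eq_sum_card_mul_pow (by rw [← pow_mul, mul_comm, pow_mul, h8, one_pow]) s N, hJ]
    exact Finset.sum_congr rfl fun x _ => by rw [← pow_mul]; simp only [hN, mul_add]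
  refine ⟨(#{x ∈ s | N x % 8 = 0} : ℤ) - #{x ∈ s | N x % 8 = 2} + #{x ∈ s | N x % 8 = 4}
      - #{x ∈ s | N x % 8 = 6},
    (#{x ∈ s | N x % 8 = 1} : ℤ) - #{x ∈ s | N x % 8 = 3} + #{x ∈ s | N x % 8 = 5}
      - #{x ∈ s | N x % 8 = 7}, ?_, ?_⟩
  all_goals
    rw [key]
    simp only [Finset.sum_range_succ, Finset.sum_range_zero]
    push_cast
    generalize (#{x ∈ s | N x % 8 = 0} : ℂ) = d0
    generalize (#{x ∈ s | N x % 8 = 1} : ℂ) = d1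
    generalize (#{x ∈ s | N x % 8 = 2} : ℂ) = d2
    generalize (#{x ∈ s | N x % 8 = 3} : ℂ) = d3
    generalize (#{x ∈ s | N x % 8 = 4} : ℂ) = d4
    generalize (#{x ∈ s | N x % 8 = 5} : ℂ) = d5
    generalize (#{x ∈ s | N x % 8 = 6} : ℂ) = d6
    generalize (#{x ∈ s | N x % 8 = 7} : ℂ) = d7
    grind

end IsOcticCharacter

/-! ### The table of octic Jacobi sums. -/

/-- The values `J r s` of the Jacobi sums `J(χ ^ r, χ ^ s)` of an octic character `χ` of `F_p`,
`p ≡ 1 mod 16`, in terms of `ε = χ 4`, two of the sums and their conjugates. -/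
structure IsOcticTable (J : ℕ → ℕ → ℂ) (p ε K K' M M' : ℂ) : Prop where
  symm : ∀ r s, J r s = J s r
  h00 : J 0 0 = p - 2
  h0 : ∀ s, ¬ 8 ∣ s → J 0 s = -1
  h17 : J 1 7 = -1
  h26 : J 2 6 = -1
  h35 : J 3 5 = -1
  h44 : J 4 4 = -1
  h11 : J 1 1 = ε * K
  h12 : J 1 2 = ε * M
  h13 : J 1 3 = K
  h14 : J 1 4 = K
  h15 : J 1 5 = ε * M
  h16 : J 1 6 = ε * K
  h22 : J 2 2 = M
  h23 : J 2 3 = ε * K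
  h24 : J 2 4 = M
  h25 : J 2 5 = ε * M
  h27 : J 2 7 = ε * K'
  h33 : J 3 3 = ε * K
  h34 : J 3 4 = K
  h36 : J 3 6 = ε * M'
  h37 : J 3 7 = ε * M'
  h45 : J 4 5 = K'
  h46 : J 4 6 = M'
  h47 : J 4 7 = K'
  h55 : J 5 5 = ε * K'
  h56 : J 5 6 = ε * K'
  h57 : J 5 7 = K'
  h66 : J 6 6 = M'
  h67 : J 6 7 = ε * M'
  h77 : J 7 7 = ε * K'

namespace IsOcticCharacter

variable {p : ℕ} [Fact p.Prime] {α : (ZMod p)ˣ} {χ : MulChar (ZMod p) ℂ} {ζ : ℂ}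

/-- The factor `χ^r(-1)` is `1` because `16 ∣ p - 1`. With commutativity, any two exponents of a
triple summing to `0` modulo `8` give the same Jacobi sum. -/
theorem jacobiSum_pow_symm (h : IsOcticCharacter α χ ζ) {r s t : ℕ} (hrst : 8 ∣ r + s + t) :
    jacobiSum (χ ^ r) (χ ^ s) = jacobiSum (χ ^ r) (χ ^ t) := by
  have h1 : (χ ^ r) (-1) = 1 := by
    have : ((-1 : (ZMod p)ˣ) : ZMod p) = -1 := by simp
    rw [← this, MulChar.pow_apply_coe, this, h.apply_neg_one, one_pow]
  have h2 : (χ ^ r * χ ^ s)⁻¹ = χ ^ t := by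
    rw [inv_eq_iff_mul_eq_one, ← pow_add, ← pow_add]
    obtain ⟨m, hm⟩ := hrst
    rw [hm, pow_mul, h.pow_eight_eq_one, one_pow]
  rw [jacobiSum_eq_jacobiSum_inv_mul, h1, one_mul, h2]

theorem isOcticTable (h : IsOcticCharacter α χ ζ) {ε : ℂ} (hε : χ 4 = ε) (hε2 : ε ^ 2 = 1) :
    IsOcticTable (fun r s => jacobiSum (χ ^ r) (χ ^ s)) p ε
      (jacobiSum (χ ^ 1) (χ ^ 3)) (jacobiSum (χ ^ 7) (χ ^ 5))
      (jacobiSum (χ ^ 2) (χ ^ 2)) (jacobiSum (χ ^ 6) (χ ^ 6)) := by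
  have hc : ∀ r s : ℕ, jacobiSum (χ ^ r) (χ ^ s) = jacobiSum (χ ^ s) (χ ^ r) :=
    fun r s => jacobiSum_comm _ _
  have h4 : ∀ r : ℕ, r ≠ 0 → (χ ^ r) 4 = ε ^ r := fun r hr => by
    rw [MulChar.pow_apply' _ hr, hε]
  have hodd : ∀ r : ℕ, ¬ 8 ∣ r → ε ^ r * jacobiSum (χ ^ r) (χ ^ r) = jacobiSum (χ ^ r) (χ ^ 4) := by
    intro r hr
    rw [← h4 r (by rintro rfl; simp at hr)]
    exact map_four_mul_jacobiSum_self (h.pow_ne_one hr) h.two_ne_zero h.card_sqrts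
  have hinv : ∀ r s : ℕ, ¬ 8 ∣ r → 8 ∣ r + s → jacobiSum (χ ^ r) (χ ^ s) = -1 := by
    intro r s hr hrs
    rw [h.jacobiSum_pow_symm (t := 0) (by omega), pow_zero, jacobiSum_comm,
      jacobiSum_one_nontrivial (h.pow_ne_one hr)]
  have hmul : ∀ r s t : ℕ, ¬ 8 ∣ r + s → ¬ 8 ∣ s + t → ¬ 8 ∣ r + s + t →
      jacobiSum (χ ^ r) (χ ^ s) * jacobiSum (χ ^ (r + s)) (χ ^ t) =
        jacobiSum (χ ^ r) (χ ^ (s + t)) * jacobiSum (χ ^ s) (χ ^ t) := by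
    intro r s t h1 h2 h3
    rw [pow_add, pow_add]
    apply jacobiSum_mul_jacobiSum
    · rw [← pow_add]; exact h.pow_ne_one h1
    · rw [← pow_add]; exact h.pow_ne_one h2
    · rw [← pow_add, ← pow_add]; exact h.pow_ne_one h3
  have hne : ∀ r : ℕ, ¬ 8 ∣ r → ¬ 8 ∣ r + 4 → jacobiSum (χ ^ r) (χ ^ 4) ≠ 0 := by
    intro r h1 h2 h0
    have e := jacobiSum_mul_jacobiSum_inv (F := ZMod p) (F' := ℂ) (χ := χ ^ r) (φ := χ ^ 4) (by
        rw [ZMod.ringChar_zmod_n, ringChar.eq_zero]; exact (Fact.out : p.Prime).ne_zero.symm)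
      (h.pow_ne_one h1) (h.pow_ne_one (by norm_num)) (by rw [← pow_add]; exact h.pow_ne_one h2)
    rw [h0, zero_mul, ZMod.card] at e
    exact (Fact.out : p.Prime).ne_zero (by exact_mod_cast e.symm)
  have hs := fun r s t => h.jacobiSum_pow_symm (r := r) (s := s) (t := t)
  have e14 := hs 1 4 3 (by norm_num)
  have e34 := (hs 3 4 1 (by norm_num)).trans (hc 3 1)
  have e74 := hs 7 4 5 (by norm_num)
  have e54 := (hs 5 4 7 (by norm_num)).trans (hc 5 7)
  have e24 := hs 2 4 2 (by norm_num)
  have e64 := hs 6 4 6 (by norm_num)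
  have hε3 : ∀ {A B : ℂ} (r : ℕ), r % 2 = 1 → ε ^ r * A = B → A = ε * B := by
    intro A B r hr e
    rw [← e, ← mul_assoc, ← pow_succ', show r + 1 = 2 * ((r + 1) / 2) by omega, pow_mul, hε2,
      one_pow, one_mul]
  have e11 := hε3 1 (by norm_num) ((hodd 1 (by norm_num)).trans e14)
  have e33 := hε3 3 (by norm_num) ((hodd 3 (by norm_num)).trans e34)
  have e55 := hε3 5 (by norm_num) ((hodd 5 (by norm_num)).trans e54)
  have e77 := hε3 7 (by norm_num) ((hodd 7 (by norm_num)).trans e74)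
  -- Symmetry and completing the square do not link `J(1,5)` to `M`. The cocycle identity gives
  -- `J(1,1) J(2,4) = J(1,5) J(1,4)`, and `J(1,4)` cancels since its product with its conjugate is
  -- `p`.
  have e15 : jacobiSum (χ ^ 1) (χ ^ 5) = ε * jacobiSum (χ ^ 2) (χ ^ 2) := by
    have := hmul 1 1 4 (by norm_num) (by norm_num) (by norm_num)
    norm_num at this
    refine mul_right_cancel₀ (hne 1 (by norm_num) (by norm_num)) ?_
    rw [pow_one] at e11 e14 ⊢
    rw [← this, e11, e24, e14]
    ring
  have e37 : jacobiSum (χ ^ 3) (χ ^ 7) = ε * jacobiSum (χ ^ 6) (χ ^ 6) := by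
    have := hmul 3 3 4 (by norm_num) (by norm_num) (by norm_num)
    norm_num at this
    refine mul_right_cancel₀ (hne 3 (by norm_num) (by norm_num)) ?_
    rw [← this, e33, e64, e34]
    ring
  exact
  { symm := hc
    h00 := by simp [jacobiSum_one_one, ZMod.card]
    h0 := fun s hs => by
      simp only [pow_zero]
      exact jacobiSum_one_nontrivial (h.pow_ne_one hs)
    h17 := hinv 1 7 (by norm_num) (by norm_num)
    h26 := hinv 2 6 (by norm_num) (by norm_num)
    h35 := hinv 3 5 (by norm_num) (by norm_num)
    h44 := hinv 4 4 (by norm_num) (by norm_num)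
    h11 := e11
    h12 := (hs 1 2 5 (by norm_num)).trans e15
    h13 := rfl
    h14 := e14
    h15 := e15
    h16 := (hs 1 6 1 (by norm_num)).trans e11
    h22 := rfl
    h23 := ((hc 2 3).trans (hs 3 2 3 (by norm_num))).trans e33
    h24 := e24
    h25 := ((hc 2 5).trans (hs 5 2 1 (by norm_num))).trans ((hc 5 1).trans e15)
    h27 := ((hc 2 7).trans (hs 7 2 7 (by norm_num))).trans e77
    h33 := e33
    h34 := e34
    h36 := (hs 3 6 7 (by norm_num)).trans e37
    h37 := e37
    h45 := (hc 4 5).trans e54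
    h46 := (hc 4 6).trans e64
    h47 := (hc 4 7).trans e74
    h55 := e55
    h56 := (hs 5 6 5 (by norm_num)).trans e55
    h57 := hc 5 7
    h66 := rfl
    h67 := ((hc 6 7).trans (hs 7 6 3 (by norm_num))).trans ((hc 7 3).trans e37)
    h77 := e77 }

theorem jacobiSum_mul_conj (h : IsOcticCharacter α χ ζ) {r s r' s' : ℕ} (hr : ¬ 8 ∣ r)
    (hs : ¬ 8 ∣ s) (hrs : ¬ 8 ∣ r + s) (hr' : 8 ∣ r + r') (hs' : 8 ∣ s + s') :
    jacobiSum (χ ^ r) (χ ^ s) * jacobiSum (χ ^ r') (χ ^ s') = p := by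
  have hinv : ∀ {m n : ℕ}, 8 ∣ m + n → (χ ^ m)⁻¹ = χ ^ n := by
    intro m n hmn
    obtain ⟨l, hl⟩ := hmn
    rw [inv_eq_iff_mul_eq_one, ← pow_add, hl, pow_mul, h.pow_eight_eq_one, one_pow]
  rw [← hinv hr', ← hinv hs', jacobiSum_mul_jacobiSum_inv (by
      rw [ZMod.ringChar_zmod_n, ringChar.eq_zero]; exact (Fact.out : p.Prime).ne_zero.symm)
    (h.pow_ne_one hr) (h.pow_ne_one hs) (by rw [← pow_add]; exact h.pow_ne_one hrs), ZMod.card]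

end IsOcticCharacter

/-! ### The Fourier transform of the table. -/

/-- The finite Fourier transform of the table of Jacobi sums, which counts representations
by elements of two cyclotomic cosets. -/
noncomputable def octicTransform (J : ℕ → ℕ → ℂ) (ω : ℂ) (i j k : ℕ) : ℂ :=
  ∑ r ∈ range 8, ∑ s ∈ range 8, ω ^ ((7 * i + k) * r % 8) * ω ^ ((7 * j + k) * s % 8) * J r s

namespace IsOcticTable

variable {J : ℕ → ℕ → ℂ} {p ε K K' M M' ω x y a b : ℂ}

theorem sum_mul (h : IsOcticTable J p ε K K' M M') (f g : ℕ → ℂ) :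
    ∑ r ∈ range 8, ∑ s ∈ range 8, f r * g s * J r s =
      f 0 * g 0 * (p - 2)
      - f 0 * (g 1 + g 2 + g 3 + g 4 + g 5 + g 6 + g 7)
      - (f 1 + f 2 + f 3 + f 4 + f 5 + f 6 + f 7) * g 0
      - (f 1 * g 7 + f 7 * g 1 + f 2 * g 6 + f 6 * g 2 + f 3 * g 5 + f 5 * g 3 + f 4 * g 4)
      + K * (f 1 * g 3 + f 3 * g 1 + f 1 * g 4 + f 4 * g 1 + f 3 * g 4 + f 4 * g 3)
      + K' * (f 5 * g 7 + f 7 * g 5 + f 7 * g 4 + f 4 * g 7 + f 5 * g 4 + f 4 * g 5)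
      + ε * K * (f 1 * g 1 + f 1 * g 6 + f 6 * g 1 + f 3 * g 3 + f 3 * g 2 + f 2 * g 3)
      + ε * K' * (f 7 * g 7 + f 7 * g 2 + f 2 * g 7 + f 5 * g 5 + f 5 * g 6 + f 6 * g 5)
      + M * (f 2 * g 2 + f 2 * g 4 + f 4 * g 2)
      + M' * (f 6 * g 6 + f 6 * g 4 + f 4 * g 6)
      + ε * M * (f 1 * g 2 + f 2 * g 1 + f 1 * g 5 + f 5 * g 1 + f 2 * g 5 + f 5 * g 2)
      + ε * M' * (f 3 * g 6 + f 6 * g 3 + f 3 * g 7 + f 7 * g 3 + f 6 * g 7 + f 7 * g 6) := by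
  obtain ⟨symm, h00, h0, h17, h26, h35, h44, h11, h12, h13, h14, h15, h16, h22, h23, h24, h25,
    h27, h33, h34, h36, h37, h45, h46, h47, h55, h56, h57, h66, h67, h77⟩ := h
  simp only [sum_range_succ, sum_range_zero]
  simp only [symm 1 0, symm 2 0, symm 3 0, symm 4 0, symm 5 0, symm 6 0, symm 7 0,
    symm 2 1, symm 3 1, symm 4 1, symm 5 1, symm 6 1, symm 7 1,
    symm 3 2, symm 4 2, symm 5 2, symm 6 2, symm 7 2,
    symm 4 3, symm 5 3, symm 6 3, symm 7 3, symm 5 4, symm 6 4, symm 7 4,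
    symm 6 5, symm 7 5, symm 7 6, h00, h0 1 (by norm_num), h0 2 (by norm_num), h0 3 (by norm_num),
    h0 4 (by norm_num), h0 5 (by norm_num), h0 6 (by norm_num), h0 7 (by norm_num),
    h17, h26, h35, h44, h11, h12, h13, h14, h15, h16, h22, h23, h24, h25,
    h27, h33, h34, h36, h37, h45, h46, h47, h55, h56, h57, h66, h67, h77]
  ring


theorem transform_zero_two_of_one
    (h : IsOcticTable J p 1 (-a + b * (ω + ω ^ 3)) (-a - b * (ω + ω ^ 3))
      (-x + y * ω ^ 2) (-x - y * ω ^ 2)) (hω : ω ^ 4 = -1) :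
    octicTransform J ω 0 2 0 = p - 7 + 6 * x + 8 * y := by
  have h5 : ω ^ 5 = -ω := by linear_combination ω * hω
  have h6 : ω ^ 6 = -ω ^ 2 := by linear_combination ω ^ 2 * hω
  have h7 : ω ^ 7 = -ω ^ 3 := by linear_combination ω ^ 3 * hω
  rw [octicTransform, h.sum_mul]
  norm_num [hω, h5, h6, h7]
  grind

/-- Only the sign of `y` differs from the `(0,2)` entry. The difference `16y` will be a multiple of
`64`, forcing `4 ∣ y`; this `y` is twice the one in the quadruple. -/
theorem transform_zero_six_of_one
    (h : IsOcticTable J p 1 (-a + b * (ω + ω ^ 3)) (-a - b * (ω + ω ^ 3))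
      (-x + y * ω ^ 2) (-x - y * ω ^ 2)) (hω : ω ^ 4 = -1) :
    octicTransform J ω 0 6 0 = p - 7 + 6 * x - 8 * y := by
  have h5 : ω ^ 5 = -ω := by linear_combination ω * hω
  have h6 : ω ^ 6 = -ω ^ 2 := by linear_combination ω ^ 2 * hω
  have h7 : ω ^ 7 = -ω ^ 3 := by linear_combination ω ^ 3 * hω
  rw [octicTransform, h.sum_mul]
  norm_num [hω, h5, h6, h7]
  grind

theorem transform_zero_one_of_one
    (h : IsOcticTable J p 1 (-a + b * (ω + ω ^ 3)) (-a - b * (ω + ω ^ 3))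
      (-x + y * ω ^ 2) (-x - y * ω ^ 2)) (hω : ω ^ 4 = -1) :
    octicTransform J ω 0 1 0 = p - 7 + 2 * x + 4 * a + 8 * y + 16 * b := by
  have h5 : ω ^ 5 = -ω := by linear_combination ω * hω
  have h6 : ω ^ 6 = -ω ^ 2 := by linear_combination ω ^ 2 * hω
  have h7 : ω ^ 7 = -ω ^ 3 := by linear_combination ω ^ 3 * hω
  rw [octicTransform, h.sum_mul]
  norm_num [hω, h5, h6, h7]
  grind

theorem transform_zero_two_of_neg_one
    (h : IsOcticTable J p (-1) (-a + b * (ω + ω ^ 3)) (-a - b * (ω + ω ^ 3))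
      (-x + y * ω ^ 2) (-x - y * ω ^ 2)) (hω : ω ^ 4 = -1) :
    octicTransform J ω 0 2 0 = p - 7 - 2 * x - 8 * a - 8 * y := by
  have h5 : ω ^ 5 = -ω := by linear_combination ω * hω
  have h6 : ω ^ 6 = -ω ^ 2 := by linear_combination ω ^ 2 * hω
  have h7 : ω ^ 7 = -ω ^ 3 := by linear_combination ω ^ 3 * hω
  rw [octicTransform, h.sum_mul]
  norm_num [hω, h5, h6, h7]
  grind

theorem transform_zero_six_of_neg_one
    (h : IsOcticTable J p (-1) (-a + b * (ω + ω ^ 3)) (-a - b * (ω + ω ^ 3))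
      (-x + y * ω ^ 2) (-x - y * ω ^ 2)) (hω : ω ^ 4 = -1) :
    octicTransform J ω 0 6 0 = p - 7 - 2 * x - 8 * a + 8 * y := by
  have h5 : ω ^ 5 = -ω := by linear_combination ω * hω
  have h6 : ω ^ 6 = -ω ^ 2 := by linear_combination ω ^ 2 * hω
  have h7 : ω ^ 7 = -ω ^ 3 := by linear_combination ω ^ 3 * hω
  rw [octicTransform, h.sum_mul]
  norm_num [hω, h5, h6, h7]
  grind

theorem transform_one_three_of_neg_one
    (h : IsOcticTable J p (-1) (-a + b * (ω + ω ^ 3)) (-a - b * (ω + ω ^ 3))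
      (-x + y * ω ^ 2) (-x - y * ω ^ 2)) (hω : ω ^ 4 = -1) :
    octicTransform J ω 1 3 0 = p + 1 + 2 * x - 4 * a - 16 * b := by
  have h5 : ω ^ 5 = -ω := by linear_combination ω * hω
  have h6 : ω ^ 6 = -ω ^ 2 := by linear_combination ω ^ 2 * hω
  have h7 : ω ^ 7 = -ω ^ 3 := by linear_combination ω ^ 3 * hω
  rw [octicTransform, h.sum_mul]
  norm_num [hω, h5, h6, h7]
  grind

/-- Expand in powers of `η = ω ^ k`, of which only `η ^ 8 = 1` matters. The term `(r, s)` carries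
`(-1)^s (1 + ω^(-r))(1 + ω^(-s)) η^(r+s)`, so odd powers of `η` cancel by symmetry of `J`, and `r`
or `s` equal to `4` drops out. The coefficient of `η⁴` vanishes because one parameter `b` serves
both `K` and `M`; those of `η²` and `η⁶` vanish because moreover `a + x = 2ε`. The constant term is
`4(p - 1)`. -/
theorem transform_add_eq_const
    (h : IsOcticTable J p ε (-a + b * (ω + ω ^ 3)) (-a - b * (ω + ω ^ 3))
      (-x + 2 * b * ω ^ 2) (-x - 2 * b * ω ^ 2)) (hω : ω ^ 4 = -1) (hε : ε ^ 2 = 1)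
    (hax : a + x = 2 * ε) (k : ℕ) :
    octicTransform J ω 0 4 k + octicTransform J ω 0 5 k + octicTransform J ω 1 4 k +
      octicTransform J ω 1 5 k = 4 * (p - 1) := by
  have h8 : ω ^ 8 = 1 := by linear_combination (ω ^ 4 - 1) * hω
  have hmod : ∀ m, ω ^ (m % 8) = ω ^ m := fun m => by
    conv_rhs => rw [← Nat.div_add_mod m 8, pow_add, pow_mul, h8, one_pow, one_mul]
  have hη : (ω ^ k) ^ 8 = 1 := by rw [← pow_mul, mul_comm, pow_mul, h8, one_pow]
  have key : octicTransform J ω 0 4 k + octicTransform J ω 0 5 k + octicTransform J ω 1 4 k +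
      octicTransform J ω 1 5 k = ∑ r ∈ range 8, ∑ s ∈ range 8,
        ((1 + ω ^ (7 * r % 8)) * (ω ^ k) ^ r) *
          ((ω ^ (28 * s % 8) + ω ^ (35 * s % 8)) * (ω ^ k) ^ s) * J r s := by
    simp only [octicTransform, ← sum_add_distrib]
    refine sum_congr rfl fun r _ => sum_congr rfl fun s _ => ?_
    simp only [hmod, ← pow_mul, add_mul, pow_add]
    ring
  have h5 : ω ^ 5 = -ω := by linear_combination ω * hω
  have h6 : ω ^ 6 = -ω ^ 2 := by linear_combination ω ^ 2 * hω
  have h7 : ω ^ 7 = -ω ^ 3 := by linear_combination ω ^ 3 * hω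
  obtain rfl : x = 2 * ε - a := by linear_combination hax
  rw [key, h.sum_mul]
  generalize ω ^ k = η at hη
  norm_num [hω, h5, h6, h7]
  grind

end IsOcticTable

/-- The transform depends on `i, j, k` only through `k - i` and `k - j` modulo `8` (the factor `7`
stands for `-1`), so a power of `ω` amounts to a relabelling of classes. -/
theorem octicTransform_pow {J : ℕ → ℕ → ℂ} {ω : ℂ} (hω : ω ^ 8 = 1) {m i j k i' j' k' : ℕ}
    (hi : m * (7 * i' + k') % 8 = (7 * i + k) % 8) (hj : m * (7 * j' + k') % 8 = (7 * j + k) % 8) :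
    octicTransform J (ω ^ m) i' j' k' = octicTransform J ω i j k := by
  have hmod : ∀ n, ω ^ n = ω ^ (n % 8) := fun n => by
    conv_lhs => rw [← Nat.div_add_mod n 8, pow_add, pow_mul, hω, one_pow, one_mul]
  refine sum_congr rfl fun r _ => sum_congr rfl fun s _ => ?_
  rw [← pow_mul, ← pow_mul, hmod (m * _), hmod (m * _)]
  congr 3
  · rw [Nat.mul_mod, Nat.mod_mod, ← Nat.mul_mod, ← mul_assoc, Nat.mul_mod, hi, ← Nat.mul_mod]
  · rw [Nat.mul_mod, Nat.mod_mod, ← Nat.mul_mod, ← mul_assoc, Nat.mul_mod, hj, ← Nat.mul_mod]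

/-! ### Counting representations by cyclotomic classes. -/

/-- The number of `x` with `x` in the `i`-th and `g - x` in the `j`-th octic class. -/
noncomputable def octicCount {p : ℕ} [Fact p.Prime] (χ : MulChar (ZMod p) ℂ) (ζ : ℂ)
    (i j : ℕ) (g : ZMod p) : ℕ :=
  {x : ZMod p | χ x = ζ ^ i ∧ χ (g - x) = ζ ^ j}.ncard

theorem mem_cyclotomicCoset_iff {p : ℕ} [Fact p.Prime] {α : (ZMod p)ˣ} {N i : ℕ} {z : ZMod p} :
    z ∈ cyclotomicCoset N α i ↔ ∃ k : ℕ, z = (α : ZMod p) ^ k ∧ k % N = i % N := by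
  constructor
  · rintro ⟨g, hg, rfl⟩
    obtain ⟨m, rfl⟩ := Submonoid.mem_powers_iff _ _ |>.1 (mem_powers_iff_mem_zpowers.2 hg)
    refine ⟨i + N * m, ?_, by simp⟩
    rw [pow_add, pow_mul]
    simp
  · rintro ⟨k, rfl, hk⟩
    have key : ∃ m : ℤ, (k : ℤ) = i + N * m := by
      have : (k : ℤ) ≡ i [ZMOD N] := by exact_mod_cast (show k ≡ i [MOD N] from hk)
      obtain ⟨m, hm⟩ := this.symm.dvd
      exact ⟨m, by linarith⟩
    obtain ⟨m, hm⟩ := key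
    refine ⟨(α ^ N) ^ m, ⟨m, rfl⟩, ?_⟩
    rw [← Units.val_pow_eq_pow_val]
    congr 1
    rw [← zpow_natCast, hm, zpow_add, zpow_mul, zpow_natCast, zpow_natCast]

namespace IsOcticCharacter

variable {p : ℕ} [Fact p.Prime] {α : (ZMod p)ˣ} {χ : MulChar (ZMod p) ℂ} {ζ : ℂ}

theorem root_ne_zero (h : IsOcticCharacter α χ ζ) : ζ ≠ 0 := by
  rintro rfl
  have := h.pow_four
  norm_num at this

theorem ne_zero_of_apply_eq (h : IsOcticCharacter α χ ζ) {i : ℕ} {z : ZMod p} (hz : χ z = ζ ^ i) :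
    z ≠ 0 := by
  rintro rfl
  rw [MulChar.map_zero] at hz
  exact pow_ne_zero i h.root_ne_zero hz.symm

theorem mem_cyclotomicCoset_eight (h : IsOcticCharacter α χ ζ) {i : ℕ} {z : ZMod p} :
    z ∈ cyclotomicCoset 8 α i ↔ χ z = ζ ^ i := by
  rw [mem_cyclotomicCoset_iff]
  constructor
  · rintro ⟨k, rfl, hk⟩
    rw [h.apply_pow, h.pow_eq_pow_iff, hk]
  · intro hz
    obtain ⟨k, rfl⟩ := h.exists_pow_of_ne_zero (h.ne_zero_of_apply_eq hz)
    rw [h.apply_pow, h.pow_eq_pow_iff] at hz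
    exact ⟨k, rfl, hz⟩

/-- `χ z = ζ ^ i` picks out exactly the elements `α ^ (8 v + i)`, `0 ≤ v < (p - 1) / 8`. -/
theorem apply_eq_pow_iff (h : IsOcticCharacter α χ ζ) {i : ℕ} {z : ZMod p} :
    χ z = ζ ^ i ↔ ∃ v < (p - 1) / 8, z = (α : ZMod p) ^ (8 * v + i) := by
  constructor
  · intro hz
    obtain ⟨g, hg, rfl⟩ := h.mem_cyclotomicCoset_eight.2 hz
    have ho : orderOf (α ^ 8) = (p - 1) / 8 := by
      rw [orderOf_pow_of_dvd (by norm_num) (by rw [h.orderOf_gen]; have := h.dvd; omega),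
        h.orderOf_gen]
    obtain ⟨m, rfl⟩ := Submonoid.mem_powers_iff _ _ |>.1 (mem_powers_iff_mem_zpowers.2 hg)
    refine ⟨m % ((p - 1) / 8), Nat.mod_lt _ (by have := h.sixteen_lt; omega), ?_⟩
    rw [← ho, pow_add, pow_mul, ← Units.val_pow_eq_pow_val, ← Units.val_pow_eq_pow_val,
      ← Units.val_pow_eq_pow_val, pow_mod_orderOf, ← Units.val_mul, mul_comm]
  · rintro ⟨v, -, rfl⟩
    rw [h.apply_pow, h.pow_eq_pow_iff]
    omega

theorem gen_pow_injOn (h : IsOcticCharacter α χ ζ) {i v w : ℕ} (hv : v < (p - 1) / 8)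
    (hw : w < (p - 1) / 8) (e : (α : ZMod p) ^ (8 * v + i) = (α : ZMod p) ^ (8 * w + i)) :
    v = w := by
  rw [← Units.val_pow_eq_pow_val, ← Units.val_pow_eq_pow_val, Units.val_inj, pow_add, pow_add] at e
  have e := mul_right_cancel e
  have := pow_injOn_Iio_orderOf (x := α) (by rw [h.orderOf_gen]; simp only [Set.mem_Iio]; omega)
    (by rw [h.orderOf_gen]; simp only [Set.mem_Iio]; omega) e
  omega

/-- Orthogonality of the powers of `χ`. It also covers `z = 0`, since even the trivial character
vanishes there. -/
theorem sum_pow_mul_apply (h : IsOcticCharacter α χ ζ) (i : ℕ) (z : ZMod p)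
    [Decidable (χ z = ζ ^ i)] :
    ∑ r ∈ range 8, ζ ^ (7 * i * r) * (χ ^ r) z = if χ z = ζ ^ i then 8 else 0 := by
  by_cases hz : z = 0
  · subst hz
    rw [if_neg fun e => h.ne_zero_of_apply_eq e rfl]
    exact sum_eq_zero fun r _ => by rw [MulChar.map_zero, mul_zero]
  · obtain ⟨w, rfl⟩ : IsUnit z := IsUnit.mk0 z hz
    obtain ⟨k, hk⟩ := h.exists_pow w
    have hχ : χ (w : ZMod p) = ζ ^ k := by rw [← hk, Units.val_pow_eq_pow_val, h.apply_pow]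
    have e : ∀ r, ζ ^ (7 * i * r) * (χ ^ r) (w : ZMod p) = (ζ ^ (7 * i + k)) ^ r := fun r => by
      rw [MulChar.pow_apply_coe, hχ, ← pow_mul, ← pow_mul, ← pow_add, add_mul]
    simp only [e, hχ]
    split_ifs with hik
    · have : ζ ^ (7 * i + k) = ζ ^ 0 := by
        rw [h.pow_eq_pow_iff] at hik ⊢
        omega
      rw [this]
      simp
    · have h1 : ζ ^ (7 * i + k) ≠ 1 := by
        rw [← pow_zero ζ]
        intro e
        rw [h.pow_eq_pow_iff] at e hik
        omega
      have := geom_sum_mul (ζ ^ (7 * i + k)) 8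
      rw [← pow_mul, mul_comm _ 8, pow_mul, h.pow_eight, one_pow, sub_self] at this
      exact (mul_eq_zero.1 this).resolve_right (sub_ne_zero.2 h1)

theorem octicCount_eq (h : IsOcticCharacter α χ ζ) (i j k : ℕ) :
    64 * (octicCount χ ζ i j ((α : ZMod p) ^ k) : ℂ) =
      octicTransform (fun r s => jacobiSum (χ ^ r) (χ ^ s)) ζ i j k := by
  classical
  set g : ZMod p := (α : ZMod p) ^ k with hg
  have e1 : 64 * (octicCount χ ζ i j g : ℂ) = ∑ x : ZMod p,
      (∑ r ∈ range 8, ζ ^ (7 * i * r) * (χ ^ r) x) *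
        (∑ s ∈ range 8, ζ ^ (7 * j * s) * (χ ^ s) (g - x)) := by
    rw [octicCount, Set.ncard_eq_toFinset_card', card_eq_sum_ones, Nat.cast_sum, mul_sum]
    simp only [h.sum_pow_mul_apply]
    simp only [Set.toFinset_ofPred, sum_filter]
    refine sum_congr rfl fun x _ => ?_
    by_cases h1 : χ x = ζ ^ i <;> by_cases h2 : χ (g - x) = ζ ^ j <;> simp [h1, h2]
    norm_num
  have e2 : ∀ r s : ℕ, ∑ x : ZMod p, (χ ^ r) x * (χ ^ s) (g - x) =
      ζ ^ (k * r) * ζ ^ (k * s) * jacobiSum (χ ^ r) (χ ^ s) := by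
    intro r s
    have hv : ∀ r : ℕ, (χ ^ r) g = ζ ^ (k * r) := fun r => by
      rw [hg, ← Units.val_pow_eq_pow_val, MulChar.pow_apply_coe, Units.val_pow_eq_pow_val,
        h.apply_pow, ← pow_mul]
    have hg0 : g ≠ 0 := pow_ne_zero _ α.ne_zero
    rw [jacobiSum, mul_sum, ← hv, ← hv]
    -- Substituting `g x` for `x` pulls `g` out and leaves a Jacobi sum.
    rw [← Equiv.sum_comp (Equiv.mulLeft₀ g hg0)]
    refine sum_congr rfl fun x _ => ?_
    change (χ ^ r) (g * x) * (χ ^ s) (g - g * x) = _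
    rw [show g - g * x = g * (1 - x) by ring, map_mul, map_mul]
    ring
  rw [e1, octicTransform]
  simp only [sum_mul_sum]
  rw [sum_comm]
  refine sum_congr rfl fun r _ => ?_
  rw [sum_comm]
  refine sum_congr rfl fun s _ => ?_
  have e3 : ∀ x : ZMod p, ζ ^ (7 * i * r) * (χ ^ r) x * (ζ ^ (7 * j * s) * (χ ^ s) (g - x)) =
      ζ ^ (7 * i * r) * ζ ^ (7 * j * s) * ((χ ^ r) x * (χ ^ s) (g - x)) := fun x => by ring
  simp only [e3]
  rw [← mul_sum, e2, ← h.pow_mod, ← h.pow_mod, add_mul, add_mul, pow_add, pow_add]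
  ring

theorem cyclotomicNumber_eq (h : IsOcticCharacter α χ ζ) (i j : ℕ) :
    64 * (cyclotomicNumber 8 α i j : ℂ) =
      octicTransform (fun r s => jacobiSum (χ ^ r) (χ ^ s)) ζ i j 0 := by
  rw [← h.octicCount_eq, pow_zero, octicCount, cyclotomicNumber]
  congr 2
  rw [← Set.ncard_coe_finset]
  -- The sign turns `1 + α^(8v+i)` into `1 - x`; it preserves the class because `χ (-1) = 1`.
  refine Set.ncard_congr (fun q _ => -(α : ZMod p) ^ (8 * q.1 + i)) ?_ ?_ ?_
  · rintro ⟨v, w⟩ hq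
    simp only [coe_filter, mem_product, mem_range, Set.mem_ofPred_eq] at hq ⊢
    rw [sub_neg_eq_add, hq.2, ← neg_one_mul, map_mul, h.apply_neg_one, one_mul]
    exact ⟨h.apply_eq_pow_iff.2 ⟨v, hq.1.1, rfl⟩, h.apply_eq_pow_iff.2 ⟨w, hq.1.2, rfl⟩⟩
  · rintro ⟨v, w⟩ ⟨v', w'⟩ hq hq' e
    simp only [coe_filter, mem_product, mem_range, Set.mem_ofPred_eq] at hq hq'
    have e := neg_injective e
    obtain rfl := h.gen_pow_injOn hq.1.1 hq'.1.1 e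
    have := hq.2.symm.trans hq'.2
    obtain rfl := h.gen_pow_injOn hq.1.2 hq'.1.2 this
    rfl
  · rintro x ⟨h1, h2⟩
    have h3 : χ (-x) = ζ ^ i := by rw [← neg_one_mul, map_mul, h.apply_neg_one, one_mul, h1]
    obtain ⟨v, hv, e⟩ := h.apply_eq_pow_iff.1 h3
    obtain ⟨w, hw, e'⟩ := h.apply_eq_pow_iff.1 h2
    refine ⟨(v, w), ?_, by simp only; rw [← e, neg_neg]⟩
    simp only [coe_filter, mem_product, mem_range, Set.mem_ofPred_eq]
    exact ⟨⟨hv, hw⟩, by rw [← e, ← e']; ring⟩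

theorem ncard_cyclotomicCoset (h : IsOcticCharacter α χ ζ) (i : ℕ) :
    (cyclotomicCoset 8 α i).ncard = (p - 1) / 8 := by
  rw [← Finset.card_range ((p - 1) / 8), ← Set.ncard_coe_finset]
  symm
  refine Set.ncard_congr (fun v _ => (α : ZMod p) ^ (8 * v + i)) ?_ ?_ ?_
  · intro v hv
    exact h.mem_cyclotomicCoset_eight.2 (h.apply_eq_pow_iff.2 ⟨v, by simpa using hv, rfl⟩)
  · intro v w hv hw e
    exact h.gen_pow_injOn (by simpa using hv) (by simpa using hw) e
  · intro z hz
    obtain ⟨v, hv, e⟩ := h.apply_eq_pow_iff.1 (h.mem_cyclotomicCoset_eight.1 hz)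
    exact ⟨v, by simpa using hv, e.symm⟩

theorem disjoint_cyclotomicCoset (h : IsOcticCharacter α χ ζ) {i j : ℕ} (hij : i % 8 ≠ j % 8) :
    Disjoint (cyclotomicCoset 8 α i) (cyclotomicCoset 8 α j) := by
  rw [Set.disjoint_left]
  intro z hi hj
  rw [h.mem_cyclotomicCoset_eight] at hi hj
  exact hij (h.pow_eq_pow_iff.1 (hi.symm.trans hj))

/-- Since `-1` lies in `C_0^8`, distinctness of the classes in the two factors keeps `0` from being
represented. For `g = α ^ k` the count splits into four octic counts, and `hsum` says that 64 times
their total is `4(p - 1)`. -/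
theorem isNearFactorization (h : IsOcticCharacter α χ ζ) {i₁ i₂ j₁ j₂ : ℕ}
    (hi : i₁ % 8 ≠ i₂ % 8) (hj : j₁ % 8 ≠ j₂ % 8) (h11 : i₁ % 8 ≠ j₁ % 8) (h12 : i₁ % 8 ≠ j₂ % 8)
    (h21 : i₂ % 8 ≠ j₁ % 8) (h22 : i₂ % 8 ≠ j₂ % 8)
    (hsum : ∀ k, octicTransform (fun r s => jacobiSum (χ ^ r) (χ ^ s)) ζ i₁ j₁ k +
      octicTransform (fun r s => jacobiSum (χ ^ r) (χ ^ s)) ζ i₁ j₂ k +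
      octicTransform (fun r s => jacobiSum (χ ^ r) (χ ^ s)) ζ i₂ j₁ k +
      octicTransform (fun r s => jacobiSum (χ ^ r) (χ ^ s)) ζ i₂ j₂ k = 4 * (p - 1)) :
    IsNearFactorization ((p - 1) / 4) ((p - 1) / 4) ((p - 1) / 16)
      (cyclotomicCoset 8 α i₁ ∪ cyclotomicCoset 8 α i₂)
      (cyclotomicCoset 8 α j₁ ∪ cyclotomicCoset 8 α j₂) := by
  have hd := h.dvd
  have hp := h.sixteen_lt
  refine ⟨?_, ?_, by omega, ?_, ?_⟩
  · rw [Set.ncard_union_eq (h.disjoint_cyclotomicCoset hi), h.ncard_cyclotomicCoset,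
      h.ncard_cyclotomicCoset]
    omega
  · rw [Set.ncard_union_eq (h.disjoint_cyclotomicCoset hj), h.ncard_cyclotomicCoset,
      h.ncard_cyclotomicCoset]
    omega
  · rw [Set.ncard_eq_zero]
    refine Set.eq_empty_of_forall_notMem ?_
    rintro ⟨z, w⟩ ⟨hz, hw, e⟩
    obtain rfl : w = -1 * z := by
      simp only at e
      linear_combination e
    simp only [Set.mem_union, h.mem_cyclotomicCoset_eight, map_mul, h.apply_neg_one,
      one_mul] at hz hw
    rcases hz with hz | hz <;> rcases hw with hw | hw <;>
      have := h.pow_eq_pow_iff.1 (hz.symm.trans hw) <;> contradiction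
  · intro g hg
    obtain ⟨k, rfl⟩ := h.exists_pow_of_ne_zero hg
    set g : ZMod p := (α : ZMod p) ^ k
    set A : ℕ → ℕ → Set (ZMod p) := fun i j => {x | χ x = ζ ^ i ∧ χ (g - x) = ζ ^ j} with hA
    have hdis : ∀ {i j i' j' : ℕ}, (i % 8 ≠ i' % 8 ∨ j % 8 ≠ j' % 8) →
        Disjoint (A i j) (A i' j') := by
      intro i j i' j' hne
      rw [Set.disjoint_left]
      rintro x ⟨h1, h2⟩ ⟨h3, h4⟩
      rcases hne with hne | hne
      · exact hne (h.pow_eq_pow_iff.1 (h1.symm.trans h3))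
      · exact hne (h.pow_eq_pow_iff.1 (h2.symm.trans h4))
    have e1 : {q : ZMod p × ZMod p | q.1 ∈ cyclotomicCoset 8 α i₁ ∪ cyclotomicCoset 8 α i₂ ∧
        q.2 ∈ cyclotomicCoset 8 α j₁ ∪ cyclotomicCoset 8 α j₂ ∧ q.1 + q.2 = g}.ncard =
        ((A i₁ j₁ ∪ A i₁ j₂) ∪ (A i₂ j₁ ∪ A i₂ j₂)).ncard := by
      refine Set.ncard_congr (fun q _ => q.1) ?_ ?_ ?_
      · rintro ⟨z, w⟩ ⟨hz, hw, e⟩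
        simp only [Set.mem_union, h.mem_cyclotomicCoset_eight] at hz hw
        obtain rfl : w = g - z := by simp only at e; linear_combination e
        simp only [hA, Set.mem_union, Set.mem_ofPred_eq]
        tauto
      · rintro ⟨z, w⟩ ⟨z', w'⟩ ⟨_, _, e⟩ ⟨_, _, e'⟩ ez
        simp only at e e' ez
        subst ez
        rw [add_left_cancel (e.trans e'.symm)]
      · intro x hx
        refine ⟨(x, g - x), ⟨?_, ?_, by simp⟩, rfl⟩ <;>
        · simp only [hA, Set.mem_union, Set.mem_ofPred_eq] at hx
          simp only [Set.mem_union, h.mem_cyclotomicCoset_eight]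
          tauto
    rw [e1, Set.ncard_union_eq, Set.ncard_union_eq (hdis (.inr hj)),
      Set.ncard_union_eq (hdis (.inr hj))]
    · have hs := hsum k
      simp only [← h.octicCount_eq] at hs
      have hs' : 64 * (octicCount χ ζ i₁ j₁ g + octicCount χ ζ i₁ j₂ g + octicCount χ ζ i₂ j₁ g +
          octicCount χ ζ i₂ j₂ g) = 4 * (p - 1) := by
        have : ((p - 1 : ℕ) : ℂ) = p - 1 := by rw [Nat.cast_sub (by omega)]; simp
        rw [← this] at hs
        rw [← mul_add, ← mul_add, ← mul_add] at hs
        exact_mod_cast hs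
      simp only [octicCount] at hs'
      simp only [hA]
      omega
    · rw [Set.disjoint_union_left, Set.disjoint_union_right, Set.disjoint_union_right]
      exact ⟨⟨hdis (.inl hi), hdis (.inl hi)⟩, ⟨hdis (.inl hi), hdis (.inl hi)⟩⟩

end IsOcticCharacter

/-! ### Existence, uniqueness and explicit values of the quadruple. -/

/-- The prime `p` divides `(xY - Xy)(xY + Xy) = p(Y² - y²)`, hence one factor `d`. Composition of
forms gives `p² = c² + n d²`, and as `n > 1` a nonzero multiple `d` of `p` would be too large. -/
theorem sq_eq_sq_of_prime_eq_sq_add_mul_sq {p n x y X Y : ℤ} (hp : Prime p) (hn : 1 < n)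
    (h : p = x ^ 2 + n * y ^ 2) (h' : p = X ^ 2 + n * Y ^ 2) : x ^ 2 = X ^ 2 ∧ y ^ 2 = Y ^ 2 := by
  have key : ∀ {d c : ℤ}, p ^ 2 = c ^ 2 + n * d ^ 2 → p ∣ d → d = 0 := by
    rintro d c e ⟨m, rfl⟩
    by_contra hm
    have hm1 : 1 ≤ m ^ 2 := by
      have : m ≠ 0 := by rintro rfl; simp at hm
      have := sq_pos_of_ne_zero this
      omega
    have hp2 : 0 < p ^ 2 := sq_pos_of_ne_zero hp.ne_zero
    nlinarith [sq_nonneg c, mul_le_mul_of_nonneg_left hm1 hp2.le]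
  have hdvd : p ∣ (x * Y - X * y) * (x * Y + X * y) :=
    ⟨Y ^ 2 - y ^ 2, by linear_combination y ^ 2 * h' - Y ^ 2 * h⟩
  have hz : (x * Y - X * y) * (x * Y + X * y) = 0 := by
    rcases hp.dvd_or_dvd hdvd with hd | hd
    · rw [key (c := x * X + n * y * Y) (by linear_combination p * h + (x ^ 2 + n * y ^ 2) * h') hd,
        zero_mul]
    · rw [key (c := x * X - n * y * Y) (by linear_combination p * h + (x ^ 2 + n * y ^ 2) * h') hd,
        mul_zero]
  have hy : y ^ 2 = Y ^ 2 := by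
    apply mul_left_cancel₀ hp.ne_zero
    linear_combination -hz + y ^ 2 * h' - Y ^ 2 * h
  exact ⟨by linear_combination h' - h - n * hy, hy⟩

theorem Int.eq_of_sq_eq_sq_of_modEq_one {x y : ℤ} (h : x ^ 2 = y ^ 2) (hx : x ≡ 1 [ZMOD 4])
    (hy : y ≡ 1 [ZMOD 4]) : x = y := by
  unfold Int.ModEq at hx hy
  rcases sq_eq_sq_iff_eq_or_eq_neg.1 h with h | h <;> omega

/-- The integers in the Jacobi sums `J(χ, χ³) ∈ ℤ[√-2]` and `J(χ², χ²) ∈ ℤ[2i]`. -/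
structure IsJacobiQuadruple {p : ℕ} [Fact p.Prime] (χ : MulChar (ZMod p) ℂ) (ζ : ℂ)
    (x y a b : ℤ) : Prop where
  one_three : jacobiSum (χ ^ 1) (χ ^ 3) = -a + b * (ζ + ζ ^ 3)
  seven_five : jacobiSum (χ ^ 7) (χ ^ 5) = -a - b * (ζ + ζ ^ 3)
  two_two : jacobiSum (χ ^ 2) (χ ^ 2) = -x + 2 * y * ζ ^ 2
  six_six : jacobiSum (χ ^ 6) (χ ^ 6) = -x - 2 * y * ζ ^ 2

theorem exists_isOcticCharacter {p : ℕ} [Fact p.Prime] {α : (ZMod p)ˣ}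
    (hα : α ∈ primitiveElements p) (hp : 16 ∣ p - 1) :
    ∃ (χ : MulChar (ZMod p) ℂ) (ζ : ℂ), IsOcticCharacter α χ ζ := by
  have hζ := Complex.isPrimitiveRoot_exp 8 (by norm_num)
  set ζ := Complex.exp (2 * Real.pi * Complex.I / (8 : ℕ))
  have h4 : ζ ^ 4 = -1 := by
    have h8 : (ζ ^ 4) * (ζ ^ 4) = 1 := by rw [← pow_add]; exact hζ.pow_eq_one
    rcases mul_self_eq_one_iff.1 h8 with h | h
    · exact absurd (hζ.dvd_of_pow_eq_one 4 h) (by norm_num)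
    · exact h
  have hu : IsUnit ζ := hζ.isUnit (by norm_num)
  have hmem : hu.unit ∈ rootsOfUnity (Fintype.card (ZMod p)ˣ) ℂ := by
    rw [mem_rootsOfUnity, ZMod.card_units]
    obtain ⟨m, hm⟩ := hp
    ext
    rw [hm, Units.val_pow_eq_pow_val, IsUnit.unit_spec, show 16 * m = 8 * (2 * m) by ring, pow_mul,
      hζ.pow_eq_one, one_pow, Units.val_one]
  have hg : ∀ x, x ∈ Subgroup.zpowers α := fun x => by
    rw [show Subgroup.zpowers α = ⊤ from hα]; trivial
  exact ⟨MulChar.ofRootOfUnity hmem hg, ζ, hα, MulChar.ofRootOfUnity_spec hmem hg, h4, hp⟩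

namespace IsOcticCharacter

variable {p : ℕ} [Fact p.Prime] {α : (ZMod p)ˣ} {χ : MulChar (ZMod p) ℂ} {ζ : ℂ}

theorem apply_four_of_mem_zero (h : IsOcticCharacter α χ ζ)
    (h2 : (2 : ZMod p) ∈ cyclotomicCoset 4 α 0) : χ 4 = 1 := by
  obtain ⟨k, hk, hk4⟩ := mem_cyclotomicCoset_iff.1 h2
  rw [show (4 : ZMod p) = 2 * 2 by norm_num, hk, ← pow_add, h.apply_pow, ← pow_zero ζ,
    h.pow_eq_pow_iff]
  omega

theorem apply_four_of_mem_two (h : IsOcticCharacter α χ ζ)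
    (h2 : (2 : ZMod p) ∈ cyclotomicCoset 4 α 2) : χ 4 = -1 := by
  obtain ⟨k, hk, hk4⟩ := mem_cyclotomicCoset_iff.1 h2
  rw [show (4 : ZMod p) = 2 * 2 by norm_num, hk, ← pow_add, h.apply_pow, ← h.pow_four,
    h.pow_eq_pow_iff]
  omega

theorem two_mem_zero_or_two (h : IsOcticCharacter α χ ζ) :
    (2 : ZMod p) ∈ cyclotomicCoset 4 α 0 ∨ (2 : ZMod p) ∈ cyclotomicCoset 4 α 2 := by
  obtain ⟨k, hk⟩ := h.exists_two_eq_pow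
  rcases Nat.even_or_odd' k with ⟨l, rfl | rfl⟩
  · exact .inl (mem_cyclotomicCoset_iff.2 ⟨_, hk, by omega⟩)
  · exact .inr (mem_cyclotomicCoset_iff.2 ⟨_, hk, by omega⟩)

theorem isOcticTable_of_jacobiSum_eq (h : IsOcticCharacter α χ ζ) {ε : ℂ} (hε : χ 4 = ε)
    (hε2 : ε ^ 2 = 1) {x y a b : ℂ}
    (h13 : jacobiSum (χ ^ 1) (χ ^ 3) = -a + b * (ζ + ζ ^ 3))
    (h75 : jacobiSum (χ ^ 7) (χ ^ 5) = -a - b * (ζ + ζ ^ 3))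
    (h22 : jacobiSum (χ ^ 2) (χ ^ 2) = -x + y * ζ ^ 2)
    (h66 : jacobiSum (χ ^ 6) (χ ^ 6) = -x - y * ζ ^ 2) :
    IsOcticTable (fun r s => jacobiSum (χ ^ r) (χ ^ s)) p ε
      (-a + b * (ζ + ζ ^ 3)) (-a - b * (ζ + ζ ^ 3)) (-x + y * ζ ^ 2) (-x - y * ζ ^ 2) := by
  rw [← h13, ← h75, ← h22, ← h66]
  exact h.isOcticTable hε hε2

/-- The Jacobi sums of an octic character, with the congruences that the integrality of the
cyclotomic numbers imposes on them. -/
theorem exists_isJacobiQuadruple (h : IsOcticCharacter α χ ζ) :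
    ∃ x y a b : ℤ, IsJacobiQuadruple χ ζ x y a b ∧ IsLehmerQuadruple α x y a b := by
  obtain ⟨a', b, h13, h75⟩ := h.exists_jacobiSum_one_three
  obtain ⟨x', Y, h22, h66⟩ := h.exists_jacobiSum_two_two
  obtain ⟨a, rfl⟩ : ∃ a, a' = -a := ⟨-a', by ring⟩
  obtain ⟨x, rfl⟩ : ∃ x, x' = -x := ⟨-x', by ring⟩
  push_cast at h13 h75 h22 h66
  have h4 := h.pow_four
  have hp16 : (p : ℤ) % 16 = 1 := by have := h.dvd; have := h.sixteen_lt; omega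
  have hab : (p : ℤ) = a ^ 2 + 2 * b ^ 2 := by
    have e := h.jacobiSum_mul_conj (r := 1) (s := 3) (r' := 7) (s' := 5) (by norm_num)
      (by norm_num) (by norm_num) (by norm_num) (by norm_num)
    rw [h13, h75] at e
    have : (p : ℂ) = a ^ 2 + 2 * b ^ 2 := by
      rw [← e]
      linear_combination (-b ^ 2 * (2 + ζ ^ 2) : ℂ) * h4
    exact_mod_cast this
  have hxY : (p : ℤ) = x ^ 2 + Y ^ 2 := by
    have e := h.jacobiSum_mul_conj (r := 2) (s := 2) (r' := 6) (s' := 6) (by norm_num)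
      (by norm_num) (by norm_num) (by norm_num) (by norm_num)
    rw [h22, h66] at e
    have : (p : ℂ) = x ^ 2 + Y ^ 2 := by
      rw [← e]
      linear_combination (-Y ^ 2 : ℂ) * h4
    exact_mod_cast this
  suffices hs : 4 ∣ Y ∧ x ≡ 1 [ZMOD 4] ∧ a ≡ 1 [ZMOD 4] ∧
      (((2 : ZMod p) ∈ cyclotomicCoset 4 α 0 ∧
        64 * (cyclotomicNumber 8 α 0 2 : ℤ) = p - 7 + 6 * x + 8 * Y ∧
        64 * (cyclotomicNumber 8 α 0 1 : ℤ) = p - 7 + 2 * x + 4 * a + 8 * Y + 16 * b) ∨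
      ((2 : ZMod p) ∈ cyclotomicCoset 4 α 2 ∧
        64 * (cyclotomicNumber 8 α 0 2 : ℤ) = p - 7 - 2 * x - 8 * a - 8 * Y ∧
        64 * (cyclotomicNumber 8 α 1 3 : ℤ) = p + 1 + 2 * x - 4 * a - 16 * b)) by
    obtain ⟨⟨z, hz⟩, hx, ha, hsigns⟩ := hs
    obtain ⟨y, rfl⟩ : ∃ y, Y = 2 * y := ⟨2 * z, by omega⟩
    refine ⟨x, y, a, b, ⟨h13, h75, ?_, ?_⟩, ⟨?_, hx, hab, ha, ?_⟩⟩
    · rw [h22]; push_cast; ring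
    · rw [h66]; push_cast; ring
    · rw [hxY]; ring
    · refine hsigns.imp (fun e => ⟨e.1, ?_, ?_⟩) (fun e => ⟨e.1, ?_, e.2.2⟩)
      · rw [e.2.1]; ring
      · rw [e.2.2]; ring
      · rw [e.2.1]; ring
  -- When `2 ∈ C_2^4`, this lets `8a` be read as `8` modulo `16`.
  have hodd : a % 2 = 1 := by
    rcases Int.emod_two_eq_zero_or_one a with ha | ha
    · obtain ⟨c, rfl⟩ := Int.dvd_of_emod_eq_zero ha
      have : (p : ℤ) = 2 * (2 * c ^ 2 + b ^ 2) := by rw [hab]; ring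
      omega
    · exact ha
  unfold Int.ModEq
  rcases h.two_mem_zero_or_two with h2 | h2
  · have ht := h.isOcticTable_of_jacobiSum_eq (h.apply_four_of_mem_zero h2) (by norm_num) h13 h75
      h22 h66
    have e02 := (h.cyclotomicNumber_eq 0 2).trans (ht.transform_zero_two_of_one h4)
    have e06 := (h.cyclotomicNumber_eq 0 6).trans (ht.transform_zero_six_of_one h4)
    have e01 := (h.cyclotomicNumber_eq 0 1).trans (ht.transform_zero_one_of_one h4)
    have e02 : 64 * (cyclotomicNumber 8 α 0 2 : ℤ) = p - 7 + 6 * x + 8 * Y := by exact_mod_cast e02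
    have e06 : 64 * (cyclotomicNumber 8 α 0 6 : ℤ) = p - 7 + 6 * x - 8 * Y := by exact_mod_cast e06
    have e01 : 64 * (cyclotomicNumber 8 α 0 1 : ℤ) = p - 7 + 2 * x + 4 * a + 8 * Y + 16 * b := by
      exact_mod_cast e01
    -- `e02 - e06` gives `4 ∣ Y`, `e02 + e06` with `p ≡ 1 mod 16` gives the congruence for `x`, and
    -- then `e01` gives the one for `a`.
    exact ⟨by omega, by omega, by omega, .inl ⟨h2, e02, e01⟩⟩
  · have ht := h.isOcticTable_of_jacobiSum_eq (h.apply_four_of_mem_two h2) (by norm_num) h13 h75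
      h22 h66
    have e02 := (h.cyclotomicNumber_eq 0 2).trans (ht.transform_zero_two_of_neg_one h4)
    have e06 := (h.cyclotomicNumber_eq 0 6).trans (ht.transform_zero_six_of_neg_one h4)
    have e13 := (h.cyclotomicNumber_eq 1 3).trans (ht.transform_one_three_of_neg_one h4)
    have e02 : 64 * (cyclotomicNumber 8 α 0 2 : ℤ) = p - 7 - 2 * x - 8 * a - 8 * Y := by
      exact_mod_cast e02
    have e06 : 64 * (cyclotomicNumber 8 α 0 6 : ℤ) = p - 7 - 2 * x - 8 * a + 8 * Y := by
      exact_mod_cast e06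
    have e13 : 64 * (cyclotomicNumber 8 α 1 3 : ℤ) = p + 1 + 2 * x - 4 * a - 16 * b := by
      exact_mod_cast e13
    exact ⟨by omega, by omega, by omega, .inr ⟨h2, e02, e13⟩⟩

theorem not_mem_zero_and_mem_two (h : IsOcticCharacter α χ ζ)
    (h0 : (2 : ZMod p) ∈ cyclotomicCoset 4 α 0) (h2 : (2 : ZMod p) ∈ cyclotomicCoset 4 α 2) :
    False := by
  have := (h.apply_four_of_mem_zero h0).symm.trans (h.apply_four_of_mem_two h2)
  norm_num at this

theorem isLehmerQuadruple_unique (h : IsOcticCharacter α χ ζ) {x y a b x' y' a' b' : ℤ}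
    (hq : IsLehmerQuadruple α x y a b) (hq' : IsLehmerQuadruple α x' y' a' b') :
    x = x' ∧ y = y' ∧ a = a' ∧ b = b' := by
  have hp : Prime (p : ℤ) := Nat.prime_iff_prime_int.1 Fact.out
  obtain rfl := Int.eq_of_sq_eq_sq_of_modEq_one
    (sq_eq_sq_of_prime_eq_sq_add_mul_sq hp (by norm_num) hq.eq_x_y hq'.eq_x_y).1 hq.x_mod hq'.x_mod
  obtain rfl := Int.eq_of_sq_eq_sq_of_modEq_one
    (sq_eq_sq_of_prime_eq_sq_add_mul_sq hp (by norm_num) hq.eq_a_b hq'.eq_a_b).1 hq.a_mod hq'.a_mod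
  rcases hq.signs with ⟨h2, e1, e2⟩ | ⟨h2, e1, e2⟩ <;>
    rcases hq'.signs with ⟨h2', e1', e2'⟩ | ⟨h2', e1', e2'⟩
  · exact ⟨rfl, by omega, rfl, by omega⟩
  · exact (h.not_mem_zero_and_mem_two h2 h2').elim
  · exact (h.not_mem_zero_and_mem_two h2' h2).elim
  · exact ⟨rfl, by omega, rfl, by omega⟩

/-- The Jacobi sums yield some Lehmer quadruple for `α`, and there is only one. -/
theorem isJacobiQuadruple (h : IsOcticCharacter α χ ζ) {x y a b : ℤ}
    (hq : IsLehmerQuadruple α x y a b) : IsJacobiQuadruple χ ζ x y a b := by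
  obtain ⟨x', y', a', b', hJ, hL⟩ := h.exists_isJacobiQuadruple
  obtain ⟨rfl, rfl, rfl, rfl⟩ := h.isLehmerQuadruple_unique hq hL
  exact hJ

theorem jacobiQuadruple_unique (h : IsOcticCharacter α χ ζ) {x y a b x' y' a' b' : ℤ}
    (hq : IsJacobiQuadruple χ ζ x y a b) (hq' : IsJacobiQuadruple χ ζ x' y' a' b') :
    x = x' ∧ y = y' ∧ a = a' ∧ b = b' := by
  have hζ := h.root_ne_zero
  have h2 : ζ + ζ ^ 3 ≠ 0 := by
    intro e
    have := h.pow_four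
    have : (2 : ℂ) = 0 := by linear_combination (ζ + ζ ^ 3) * e * (-1) + (2 + ζ ^ 2) * this
    norm_num at this
  have e1 := hq.one_three.symm.trans hq'.one_three
  have e2 := hq.seven_five.symm.trans hq'.seven_five
  have e3 := hq.two_two.symm.trans hq'.two_two
  have e4 := hq.six_six.symm.trans hq'.six_six
  refine ⟨?_, ?_, ?_, ?_⟩
  · have : (x : ℂ) = x' := by linear_combination (-1 / 2 : ℂ) * (e3 + e4)
    exact_mod_cast this
  · have : (y : ℂ) = y' := by
      apply mul_right_cancel₀ (pow_ne_zero 2 hζ)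
      linear_combination (1 / 4 : ℂ) * (e3 - e4)
    exact_mod_cast this
  · have : (a : ℂ) = a' := by linear_combination (-1 / 2 : ℂ) * (e1 + e2)
    exact_mod_cast this
  · have : (b : ℂ) = b' := by
      apply mul_right_cancel₀ h2
      linear_combination (1 / 2 : ℂ) * (e1 - e2)
    exact_mod_cast this

/-- Replacing `α` by a suitable power congruent to its cube changes the sign of `y` only. -/
theorem exists_neg (h : IsOcticCharacter α χ ζ) {x y a b : ℤ} (hq : IsLehmerQuadruple α x y a b) :
    ∃ β ∈ primitiveElements p, IsLehmerQuadruple β x (-y) a b := by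
  have h8 : 8 ∣ p - 1 := by have := h.dvd; omega
  have : NeZero (p - 1) := ⟨by have := h.sixteen_lt; omega⟩
  -- Lift `3` modulo `8` to an exponent prime to `p - 1`. The same `χ` then takes the value `ζ³` at
  -- the new generator; `ζ ↦ ζ³` fixes `ζ + ζ³` and negates `ζ²`.
  obtain ⟨v, hv⟩ := ZMod.unitsMap_surjective h8 (ZMod.unitOfCoprime 3 (by norm_num))
  set m := (v : ZMod (p - 1)).val with hm
  have hcop : m.Coprime (p - 1) := ZMod.val_coe_unit_coprime v
  have hm8 : m % 8 = 3 := by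
    have e := congrArg (fun w : (ZMod 8)ˣ => (w : ZMod 8)) hv
    simp only [ZMod.unitsMap_val, ZMod.coe_unitOfCoprime] at e
    rw [ZMod.cast_eq_val] at e
    have := (ZMod.natCast_eq_natCast_iff' _ _ _).1 e
    simpa using this
  have hβ : α ^ m ∈ primitiveElements p := by
    change Subgroup.zpowers (α ^ m) = ⊤
    rw [← show Subgroup.zpowers α = ⊤ from h.primitive]
    refine Subgroup.eq_of_le_of_card_ge ?_ ?_
    · exact Subgroup.zpowers_le.2 (pow_mem (Subgroup.mem_zpowers α) m)
    · rw [Nat.card_zpowers, Nat.card_zpowers, Nat.Coprime.orderOf_pow]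
      rw [h.orderOf_gen]
      exact hcop.symm
  have h4 := h.pow_four
  have h' : IsOcticCharacter (α ^ m) χ (ζ ^ 3) :=
    ⟨hβ, by rw [Units.val_pow_eq_pow_val, h.apply_pow, h.pow_eq_pow_iff, hm8],
      by rw [← pow_mul, mul_comm, pow_mul, h4]; norm_num, h.dvd⟩
  obtain ⟨x', y', a', b', hJ, hL⟩ := h'.exists_isJacobiQuadruple
  have hJ' := h.isJacobiQuadruple hq
  have h3 : ζ ^ 3 + (ζ ^ 3) ^ 3 = ζ + ζ ^ 3 := by linear_combination (ζ ^ 5 - ζ) * h4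
  have h6 : (ζ ^ 3) ^ 2 = - ζ ^ 2 := by linear_combination ζ ^ 2 * h4
  have hJ2 : IsJacobiQuadruple χ (ζ ^ 3) x (-y) a b := by
    refine ⟨?_, ?_, ?_, ?_⟩
    · rw [h3, hJ'.one_three]
    · rw [h3, hJ'.seven_five]
    · rw [h6, hJ'.two_two]; push_cast; ring
    · rw [h6, hJ'.six_six]; push_cast; ring
  obtain ⟨rfl, rfl, rfl, rfl⟩ := h'.jacobiQuadruple_unique hJ hJ2
  exact ⟨_, hβ, hL⟩

end IsOcticCharacter

/-- For `p = 4u² + 12u + 1` with `u` a square, the Lehmer quadruple is explicit up to signs, and the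
integrality of the cyclotomic numbers links the parity of `u` to the quartic character of `2`. -/
theorem IsLehmerQuadruple.sq_eq_and_add_eq {u p : ℕ} [Fact p.Prime] {α : (ZMod p)ˣ} {x y a b : ℤ}
    (hu : IsSquare u) (hp : p = 4 * u ^ 2 + 12 * u + 1) (hq : IsLehmerQuadruple α x y a b) :
    y ^ 2 = 4 * u ∧ b ^ 2 = 4 * u ∧
      ((2 : ZMod p) ∈ cyclotomicCoset 4 α 0 ∧ a + x = 2 ∨
        (2 : ZMod p) ∈ cyclotomicCoset 4 α 2 ∧ a + x = -2) := by
  obtain ⟨v, hv⟩ := hu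
  have hv' : (u : ℤ) = v * v := by exact_mod_cast hv
  have hpZ : (p : ℤ) = 4 * u ^ 2 + 12 * u + 1 := by exact_mod_cast hp
  have hpp : Prime (p : ℤ) := Nat.prime_iff_prime_int.1 Fact.out
  obtain ⟨hx, hy⟩ := sq_eq_sq_of_prime_eq_sq_add_mul_sq (X := 2 * u - 1) (Y := 2 * v) hpp
    (by norm_num) hq.eq_x_y (by rw [hpZ, mul_pow]; linear_combination (16 : ℤ) * hv')
  obtain ⟨ha, hb⟩ := sq_eq_sq_of_prime_eq_sq_add_mul_sq (X := 2 * u + 1) (Y := 2 * v) hpp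
    (by norm_num) hq.eq_a_b (by rw [hpZ, mul_pow]; linear_combination (8 : ℤ) * hv')
  refine ⟨by rw [hy, hv']; ring, by rw [hb, hv']; ring, ?_⟩
  have hxm := hq.x_mod
  have ham := hq.a_mod
  unfold Int.ModEq at hxm ham
  have hx' := sq_eq_sq_iff_eq_or_eq_neg.1 hx
  have hy' := sq_eq_sq_iff_eq_or_eq_neg.1 hy
  have ha' := sq_eq_sq_iff_eq_or_eq_neg.1 ha
  rcases Nat.even_or_odd' v with ⟨w, rfl | rfl⟩
  · obtain ⟨t, ht⟩ : ∃ t : ℤ, (u : ℤ) = 4 * t := ⟨w * w, by rw [hv']; push_cast; ring⟩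
    have hx2 : x = 1 - 8 * t := by omega
    have ha2 : a = 8 * t + 1 := by omega
    rcases hq.signs with ⟨h2, -, -⟩ | ⟨h2, e, -⟩
    · exact .inl ⟨h2, by omega⟩
    -- Here `64 (0,2) = 64t² - 16 - 16y` with `4 ∣ y`, which is `-16` modulo `64`.
    · exfalso
      have hp2 : (p : ℤ) = 64 * t ^ 2 + 48 * t + 1 := by rw [hpZ, ht]; ring
      push_cast at hy'
      omega
  · obtain ⟨t, ht⟩ : ∃ t : ℤ, (u : ℤ) = 8 * t + 1 := by
      obtain ⟨s, hs⟩ := Int.even_mul_succ_self (w : ℤ)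
      exact ⟨s, by rw [hv']; push_cast; linear_combination 4 * hs⟩
    have hx2 : x = 16 * t + 1 := by omega
    have ha2 : a = -16 * t - 3 := by omega
    rcases hq.signs with ⟨h2, e, -⟩ | ⟨h2, -, -⟩
    -- Here `64 (0,2) = 256t² + 256t + 16 + 16y` with `y` twice an odd number, which is `48` modulo
    -- `64`.
    · exfalso
      have hp2 : (p : ℤ) = 256 * t ^ 2 + 160 * t + 17 := by rw [hpZ, ht]; ring
      push_cast at hy'
      omega
    · exact .inr ⟨h2, by omega⟩

/-! ### The near-factorizations for either sign. -/

namespace IsOcticCharacter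

variable {p : ℕ} [Fact p.Prime] {α : (ZMod p)ˣ} {χ : MulChar (ZMod p) ℂ} {ζ : ℂ}

theorem transform_add_eq_const_of_pow (h : IsOcticCharacter α χ ζ) {x y a b : ℤ}
    (hq : IsLehmerQuadruple α x y a b)
    (hax : (2 : ZMod p) ∈ cyclotomicCoset 4 α 0 ∧ a + x = 2 ∨
        (2 : ZMod p) ∈ cyclotomicCoset 4 α 2 ∧ a + x = -2) {m : ℕ}
    (hm : m = 1 ∧ y = b ∨ m = 5 ∧ y = -b) (k : ℕ) :
    octicTransform (fun r s => jacobiSum (χ ^ r) (χ ^ s)) (ζ ^ m) 0 4 k +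
      octicTransform (fun r s => jacobiSum (χ ^ r) (χ ^ s)) (ζ ^ m) 0 5 k +
      octicTransform (fun r s => jacobiSum (χ ^ r) (χ ^ s)) (ζ ^ m) 1 4 k +
      octicTransform (fun r s => jacobiSum (χ ^ r) (χ ^ s)) (ζ ^ m) 1 5 k = 4 * (p - 1) := by
  have hJ := h.isJacobiQuadruple hq
  have h4 := h.pow_four
  obtain ⟨ε, hε, hε2, hax⟩ : ∃ ε : ℂ, χ 4 = ε ∧ ε ^ 2 = 1 ∧ (a : ℂ) + x = 2 * ε := by
    rcases hax with ⟨h2, e⟩ | ⟨h2, e⟩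
    · exact ⟨1, h.apply_four_of_mem_zero h2, by norm_num, by norm_num; exact_mod_cast e⟩
    · exact ⟨-1, h.apply_four_of_mem_two h2, by norm_num, by norm_num; exact_mod_cast e⟩
  have ht := h.isOcticTable_of_jacobiSum_eq hε hε2 hJ.one_three hJ.seven_five hJ.two_two hJ.six_six
  rcases hm with ⟨rfl, rfl⟩ | ⟨rfl, rfl⟩
  · rw [pow_one]
    exact ht.transform_add_eq_const h4 hε2 hax k
  -- In terms of `ω = ζ⁵` the Jacobi sums are unchanged but `ω + ω³ = -(ζ + ζ³)` and `ω² = ζ²`, so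
  -- `-b` replaces `b` and agrees with `y`.
  · refine IsOcticTable.transform_add_eq_const (b := -b) (ε := ε) (a := a) (x := x) ?_
      (by rw [← pow_mul, mul_comm, pow_mul, h4]; norm_num) hε2 hax k
    have e1 : ζ ^ 5 + (ζ ^ 5) ^ 3 = -(ζ + ζ ^ 3) := by
      linear_combination (ζ + ζ ^ 11 - ζ ^ 7 + ζ ^ 3) * h4
    have e2 : (ζ ^ 5) ^ 2 = ζ ^ 2 := by linear_combination (ζ ^ 6 - ζ ^ 2) * h4
    rw [e1, e2]
    convert ht using 1 <;> push_cast <;> ring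

theorem isNearFactorization_of_eq (h : IsOcticCharacter α χ ζ) {x b a : ℤ}
    (hq : IsLehmerQuadruple α x b a b)
    (hax : (2 : ZMod p) ∈ cyclotomicCoset 4 α 0 ∧ a + x = 2 ∨
        (2 : ZMod p) ∈ cyclotomicCoset 4 α 2 ∧ a + x = -2) :
    IsNearFactorization ((p - 1) / 4) ((p - 1) / 4) ((p - 1) / 16)
        (cyclotomicCoset 8 α 0 ∪ cyclotomicCoset 8 α 1)
        (cyclotomicCoset 8 α 4 ∪ cyclotomicCoset 8 α 5) ∧
      IsNearFactorization ((p - 1) / 4) ((p - 1) / 4) ((p - 1) / 16)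
        (cyclotomicCoset 8 α 0 ∪ cyclotomicCoset 8 α 7)
        (cyclotomicCoset 8 α 3 ∪ cyclotomicCoset 8 α 4) := by
  have key := h.transform_add_eq_const_of_pow hq hax (m := 1) (.inl ⟨rfl, rfl⟩)
  refine ⟨h.isNearFactorization (by norm_num) (by norm_num) (by norm_num) (by norm_num)
      (by norm_num) (by norm_num) fun k => ?_,
    h.isNearFactorization (by norm_num) (by norm_num) (by norm_num) (by norm_num)
      (by norm_num) (by norm_num) fun k => ?_⟩
  · simpa using key k
  -- Shifting `k` by one lowers every class index by one: the second pair is `α⁻¹` times the first.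
  · rw [← key (k + 1),
      octicTransform_pow h.pow_eight (i := 7) (j := 3) (k := k) (by omega) (by omega),
      octicTransform_pow h.pow_eight (i := 7) (j := 4) (k := k) (by omega) (by omega),
      octicTransform_pow h.pow_eight (i := 0) (j := 3) (k := k) (by omega) (by omega),
      octicTransform_pow h.pow_eight (i := 0) (j := 4) (k := k) (by omega) (by omega)]
    ring

theorem isNearFactorization_of_eq_neg (h : IsOcticCharacter α χ ζ) {x a b : ℤ}
    (hq : IsLehmerQuadruple α x (-b) a b)
    (hax : (2 : ZMod p) ∈ cyclotomicCoset 4 α 0 ∧ a + x = 2 ∨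
        (2 : ZMod p) ∈ cyclotomicCoset 4 α 2 ∧ a + x = -2) :
    IsNearFactorization ((p - 1) / 4) ((p - 1) / 4) ((p - 1) / 16)
        (cyclotomicCoset 8 α 0 ∪ cyclotomicCoset 8 α 5)
        (cyclotomicCoset 8 α 1 ∪ cyclotomicCoset 8 α 4) ∧
      IsNearFactorization ((p - 1) / 4) ((p - 1) / 4) ((p - 1) / 16)
        (cyclotomicCoset 8 α 0 ∪ cyclotomicCoset 8 α 3)
        (cyclotomicCoset 8 α 4 ∪ cyclotomicCoset 8 α 7) := by
  have key := h.transform_add_eq_const_of_pow hq hax (m := 5) (.inr ⟨rfl, rfl⟩)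
  refine ⟨h.isNearFactorization (by norm_num) (by norm_num) (by norm_num) (by norm_num)
      (by norm_num) (by norm_num) fun k => ?_,
    h.isNearFactorization (by norm_num) (by norm_num) (by norm_num) (by norm_num)
      (by norm_num) (by norm_num) fun k => ?_⟩
  -- Returning from `ζ⁵` to `ζ` multiplies class indices by `5`: `{0,1}, {4,5}` become `{0,5},
  -- {4,1}`.
  · rw [← key (5 * k),
      octicTransform_pow h.pow_eight (i := 0) (j := 4) (k := k) (by omega) (by omega),
      octicTransform_pow h.pow_eight (i := 0) (j := 1) (k := k) (by omega) (by omega),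
      octicTransform_pow h.pow_eight (i := 5) (j := 4) (k := k) (by omega) (by omega),
      octicTransform_pow h.pow_eight (i := 5) (j := 1) (k := k) (by omega) (by omega)]
    ring
  -- The extra shift multiplies the previous pair by `α³`.
  · rw [← key (5 * k + 1),
      octicTransform_pow h.pow_eight (i := 3) (j := 7) (k := k) (by omega) (by omega),
      octicTransform_pow h.pow_eight (i := 3) (j := 4) (k := k) (by omega) (by omega),
      octicTransform_pow h.pow_eight (i := 0) (j := 7) (k := k) (by omega) (by omega),
      octicTransform_pow h.pow_eight (i := 0) (j := 4) (k := k) (by omega) (by omega)]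
    ring

end IsOcticCharacter

theorem sixteen_dvd_of_isSquare {u : ℕ} (hu : IsSquare u) : 16 ∣ 4 * u ^ 2 + 12 * u := by
  obtain ⟨v, rfl⟩ := hu
  rcases Nat.even_or_odd' v with ⟨w, rfl | rfl⟩
  · exact ⟨4 * w ^ 4 + 3 * w ^ 2, by ring⟩
  · exact ⟨4 * w ^ 4 + 8 * w ^ 3 + 9 * w ^ 2 + 5 * w + 1, by ring⟩

end

theorem theorem1p1 (u p : ℕ) [Fact p.Prime] (hu : IsSquare u) (hu0 : u ≠ 0)
    (hp : p = 4 * u ^ 2 + 12 * u + 1) :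
    -- `x_α, y_α, a_α, b_α` are well defined for every primitive element `α`
    (∀ α ∈ primitiveElements p,
      ∃! q : ℤ × ℤ × ℤ × ℤ, IsLehmerQuadruple α q.1 q.2.1 q.2.2.1 q.2.2.2) ∧
    -- `U_p` is the disjoint union of `U_p^+` and `U_p^-`, both of which are nonempty
    primitivePlus p ∪ primitiveMinus p = primitiveElements p ∧
    Disjoint (primitivePlus p) (primitiveMinus p) ∧
    (primitivePlus p).Nonempty ∧
    (primitiveMinus p).Nonempty ∧
    (∀ α ∈ primitivePlus p,
      IsNearFactorization ((p - 1) / 4) ((p - 1) / 4) ((p - 1) / 16)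
        (cyclotomicCoset 8 α 0 ∪ cyclotomicCoset 8 α 1)
        (cyclotomicCoset 8 α 4 ∪ cyclotomicCoset 8 α 5) ∧
      IsNearFactorization ((p - 1) / 4) ((p - 1) / 4) ((p - 1) / 16)
        (cyclotomicCoset 8 α 0 ∪ cyclotomicCoset 8 α 7)
        (cyclotomicCoset 8 α 3 ∪ cyclotomicCoset 8 α 4)) ∧
    (∀ α ∈ primitiveMinus p,
      IsNearFactorization ((p - 1) / 4) ((p - 1) / 4) ((p - 1) / 16)
        (cyclotomicCoset 8 α 0 ∪ cyclotomicCoset 8 α 5)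
        (cyclotomicCoset 8 α 1 ∪ cyclotomicCoset 8 α 4) ∧
      IsNearFactorization ((p - 1) / 4) ((p - 1) / 4) ((p - 1) / 16)
        (cyclotomicCoset 8 α 0 ∪ cyclotomicCoset 8 α 3)
        (cyclotomicCoset 8 α 4 ∪ cyclotomicCoset 8 α 7)) := by 
  have h16 : 16 ∣ p - 1 := by
    rw [hp, Nat.add_sub_cancel]
    exact sixteen_dvd_of_isSquare hu
  have hex : ∀ α ∈ primitiveElements p, ∃ x y a b : ℤ, IsLehmerQuadruple α x y a b ∧
      (y = b ∨ y = -b) := by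
    intro α hα
    obtain ⟨χ, ζ, h⟩ := exists_isOcticCharacter hα h16
    obtain ⟨x, y, a, b, -, hq⟩ := h.exists_isJacobiQuadruple
    obtain ⟨hy, hb, -⟩ := hq.sq_eq_and_add_eq hu hp
    exact ⟨x, y, a, b, hq, sq_eq_sq_iff_eq_or_eq_neg.1 (hy.trans hb.symm)⟩
  obtain ⟨α, hα⟩ : ∃ α : (ZMod p)ˣ, α ∈ primitiveElements p := by
    obtain ⟨α, hα⟩ := IsCyclic.exists_generator (α := (ZMod p)ˣ)
    exact ⟨α, (Subgroup.eq_top_iff' _).2 hα⟩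
  obtain ⟨χ, ζ, h⟩ := exists_isOcticCharacter hα h16
  obtain ⟨x, y, a, b, hq, hyb⟩ := hex α hα
  obtain ⟨β, hβ, hq'⟩ := h.exists_neg hq
  refine ⟨?_, ?_, ?_, ?_, ?_, ?_, ?_⟩
  · intro α hα
    obtain ⟨χ, ζ, h⟩ := exists_isOcticCharacter hα h16
    obtain ⟨x, y, a, b, hq, -⟩ := hex α hα
    refine ⟨(x, y, a, b), hq, ?_⟩
    rintro ⟨x', y', a', b'⟩ hq'
    obtain ⟨rfl, rfl, rfl, rfl⟩ := h.isLehmerQuadruple_unique hq hq'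
    rfl
  · ext α
    constructor
    · rintro (hα | hα)
      · exact hα.1
      · exact hα.1
    · intro hα
      obtain ⟨x, y, a, b, hq, hy | hy⟩ := hex α hα
      · exact .inl ⟨hα, x, y, a, b, hq, hy⟩
      · exact .inr ⟨hα, x, y, a, b, hq, hy⟩
  · rw [Set.disjoint_left]
    rintro α ⟨hα, x, y, a, b, hq, hy⟩ ⟨-, x', y', a', b', hq', hy'⟩
    obtain ⟨χ, ζ, h⟩ := exists_isOcticCharacter hα h16
    obtain ⟨rfl, rfl, rfl, rfl⟩ := h.isLehmerQuadruple_unique hq hq'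
    obtain ⟨hy2, -, -⟩ := hq.sq_eq_and_add_eq hu hp
    obtain rfl : y = 0 := by omega
    have : (u : ℤ) = 0 := by linarith
    exact hu0 (by exact_mod_cast this)
  · rcases hyb with hy | hy
    · exact ⟨α, hα, x, y, a, b, hq, hy⟩
    · exact ⟨β, hβ, x, -y, a, b, hq', by rw [hy, neg_neg]⟩
  · rcases hyb with hy | hy
    · exact ⟨β, hβ, x, -y, a, b, hq', by rw [hy]⟩
    · exact ⟨α, hα, x, y, a, b, hq, hy⟩
  · rintro α ⟨hα, x, y, a, b, hq, rfl⟩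
    obtain ⟨χ, ζ, h⟩ := exists_isOcticCharacter hα h16
    exact h.isNearFactorization_of_eq hq (hq.sq_eq_and_add_eq hu hp).2.2
  · rintro α ⟨hα, x, y, a, b, hq, rfl⟩
    obtain ⟨χ, ζ, h⟩ := exists_isOcticCharacter hα h16
    exact h.isNearFactorization_of_eq_neg hq (hq.sq_eq_and_add_eq hu hp).2.2
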